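/- **Theorem 4.4.** Let $n\ge 1$, let $J_1,\dots,J_n$ be independent $\mathrm{Be}(1/2)$ random indicators, let $J_{n+1}=1$ if $\sum_{i=1}^n J_i$ is odd and $J_{n+1}=0$ otherwise, and put $V=\sum_{i=1}^{n+1}J_i$, $W=V/2$, $\mu=\mathbb E W$, $\sigma^2=\operatorname{Var}W$. Independently of the $J_i$, let $(K,L)$ be uniformly distributed over the ordered pairs of distinct elements of $\{1,\dots,n+1\}$, and put $V'=V+2-2J_K-2J_L$, $W'=V'/2$, $S=\mathbb P[W'=W+1\mid W]$, $q_{\max}=\max_{k\in\mathbb Z}\mathbb P[W=k]$. For probability measures $P,Q$ on $\mathbb Z$ let $d_{\mathrm{TV}}(P,Q)=\sup_{A\subset\mathbb Z}|P(A)-Q(A)|$ and $d_{\mathrm{loc}}(P,Q)=\sup_{k\in\mathbb Z}|P\{k\}-Q\{k\}|$. Let $\mathrm{TP}(\mu,\sigma^2)$ be the law of $Z+\lfloor\mu-\sigma^2\rfloor$, where $Z$ is Poisson with mean $\sigma^2+\gamma$ and $\gamma=(\mu-\sigma^2)-\lfloor\mu-\sigma^2\rfloor$. 1. $(W,W')$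 is an exchangeable pair, $W'-W\in\{-1,0,1\}$, and $\mathbb E[W'-\mu\mid W]=(1-\frac{4}{n+1})(W-\mu)+R$ almost surely with $R\equiv 0$. 2. With $R\equiv0$ and $\lambda=2/(n+1)$, and also with $R\equiv 0$ and the sharper constant $\lambda=4/(n+1)$, $$d_{\mathrm{TV}}(\mathcal L(W),\mathrm{TP}(\mu,\sigma^2))\le\frac{\sqrt{\operatorname{Var}S}}{\lambda\sigma^2}+\frac{2\sqrt{\operatorname{Var}R}}{\lambda\sigma}+\frac{2}{\sigma^2},\tag{3.1}$$ $$d_{\mathrm{loc}}(\mathcal L(W),\mathrm{TP}(\mu,\sigma^2))\le\frac{2\sqrt{q_{\max}\operatorname{Var}S}}{\lambda\sigma^2}+\frac{2q_{\max}\sqrt{\operatorname{Var}R}}{\lambda\sigma}+\frac{\sqrt{\operatorname{Var}R}}{\lambda\sigma^2}+\frac{2}{\sigma^2}.\tag{3.2}$$ 3. If $n\ge2$, then $\sigma^2=\dfrac{n+1}{16}$ and $\operatorname{Var}S\le\dfrac{(4n-2)^2(n+1)}{16n^2(n+1)^2}$. 4. There is an absolute constant $C$ such that, for all $n\ge1$,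 $d_{\mathrm{TV}}(\mathcal L(W),\mathrm{TP}(\mu,\sigma^2))\le Cn^{-1/2}$ and $d_{\mathrm{loc}}(\mathcal L(W),\mathrm{TP}(\mu,\sigma^2))\le Cn^{-1}$. -/

import Mathlib

open MeasureTheory ProbabilityTheory

namespace ParityProblem

/-! ### Metrics on laws on the integers, and the translated Poisson distribution -/

/-- Total variation distance `sup_A |P(A) - Q(A)|` of two (probability) measures on `ℤ`. -/
noncomputable def dTV (P Q : Measure ℤ) : ℝ :=
  ⨆ A : Set ℤ, |P.real A - Q.real A|

/-- Local limit metric `sup_k |P{k} - Q{k}|` of two (probability) measures on `ℤ`. -/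
noncomputable def dLoc (P Q : Measure ℤ) : ℝ :=
  ⨆ k : ℤ, |P.real {k} - Q.real {k}|

/-- The translated Poisson distribution `TP(μ, σ²)`: the law of `Z + ⌊μ - σ²⌋`, where `Z` is
Poisson with mean `σ² + γ` and `γ` is the fractional part of `μ - σ²`. Equivalently (as
`⌊μ - σ²⌋ = μ - σ² - γ`), `Y ~ TP(μ, σ²)` iff `Y - μ + σ² + γ ~ Po(σ² + γ)`. -/
noncomputable def translatedPoisson (μ σ2 : ℝ) : Measure ℤ :=
  (poissonMeasure (σ2 + Int.fract (μ - σ2)).toNNReal).map (fun k : ℕ => (k : ℤ) + ⌊μ - σ2⌋)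

/-! ### General quantities attached to a pair `(W, W')` of integer valued random variables -/

section Pair

variable {Ω : Type*} [MeasurableSpace Ω]

/-- The law of `W`. -/
noncomputable def law (P : Measure Ω) (W : Ω → ℤ) : Measure ℤ := P.map W

/-- `μ = 𝔼 W`. -/
noncomputable def mean (P : Measure Ω) (W : Ω → ℤ) : ℝ := ∫ ω, (W ω : ℝ) ∂P

/-- `σ² = Var W`. -/
noncomputable def var (P : Measure Ω) (W : Ω → ℤ) : ℝ := variance (fun ω => (W ω : ℝ)) P

/-- The `σ`-algebra generated by `W`. -/
abbrev sigmaAlg (W : Ω → ℤ) : MeasurableSpace Ω := MeasurableSpace.comap W inferInstance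

/-- `S = S(W) = ℙ[W' = W + 1 | W]`. -/
noncomputable def upProb (P : Measure Ω) (W W' : Ω → ℤ) : Ω → ℝ :=
  P[({ω | W' ω = W ω + 1} : Set Ω).indicator (fun _ => (1 : ℝ)) | sigmaAlg W]

/-- `q_max = max_k ℙ[W = k]`. -/
noncomputable def qMax (P : Measure Ω) (W : Ω → ℤ) : ℝ :=
  ⨆ k : ℤ, P.real {ω | W ω = k}

/-- `(W, W')` is an exchangeable pair. -/
def IsExchangeablePair (P : Measure Ω) (W W' : Ω → ℤ) : Prop :=
  P.map (fun ω => (W ω, W' ω)) = P.map (fun ω => (W' ω, W ω))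

/-- The linear regression property `𝔼[W' - μ | W] = (1 - λ) (W - μ) + R` almost surely. -/
def LinearRegression (P : Measure Ω) (W W' : Ω → ℤ) (lam : ℝ) (R : Ω → ℝ) : Prop :=
  P[fun ω => (W' ω : ℝ) - mean P W | sigmaAlg W]
    =ᵐ[P] fun ω => (1 - lam) * ((W ω : ℝ) - mean P W) + R ω

/-- The total variation bound
`d_TV(ℒ(W), TP(μ, σ²)) ≤ √(Var S) / (λ σ²) + 2 √(Var R) / (λ σ) + 2 / σ²`. -/
def TVBound (P : Measure Ω) (W W' : Ω → ℤ) (lam : ℝ) (R : Ω → ℝ) : Prop :=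
  dTV (law P W) (translatedPoisson (mean P W) (var P W)) ≤
    √(variance (upProb P W W') P) / (lam * var P W)
      + 2 * √(variance R P) / (lam * √(var P W))
      + 2 / var P W

/-- The local limit bound
`d_loc(ℒ(W), TP(μ, σ²)) ≤ 2 √(q_max Var S) / (λ σ²) + 2 q_max √(Var R) / (λ σ)
  + √(Var R) / (λ σ²) + 2 / σ²`. -/
def LocBound (P : Measure Ω) (W W' : Ω → ℤ) (lam : ℝ) (R : Ω → ℝ) : Prop :=
  dLoc (law P W) (translatedPoisson (mean P W) (var P W)) ≤
    2 * √(qMax P W * variance (upProb P W W') P) / (lam * var P W)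
      + 2 * qMax P W * √(variance R P) / (lam * √(var P W))
      + √(variance R P) / (lam * var P W)
      + 2 / var P W

end Pair

/-! ### The parity construction -/

/-- The bits `x₁, …, xₙ` followed by the parity bit, which is `1` iff `x₁ + ⋯ + xₙ` is odd. -/
def withParity {n : ℕ} (x : Fin n → Bool) : Fin (n + 1) → Bool :=
  Fin.snoc (α := fun _ => Bool) x (decide (Odd (∑ i, (x i).toNat)))

section Model

variable {Ω : Type*} {n : ℕ}

/-- The numbers `J₁, …, Jₙ, Jₙ₊₁ ∈ {0, 1}`, where `Jₙ₊₁` is the parity bit. -/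
def bit (J : Fin n → Ω → Bool) (k : Fin (n + 1)) (ω : Ω) : ℤ :=
  ((withParity (fun i => J i ω) k).toNat : ℤ)

/-- `V = J₁ + ⋯ + Jₙ₊₁`. -/
def V (J : Fin n → Ω → Bool) (ω : Ω) : ℤ := ∑ k, bit J k ω

/-- `V' = V + 2 - 2 J_K - 2 J_L`. -/
def V' (J : Fin n → Ω → Bool) (K L : Ω → Fin (n + 1)) (ω : Ω) : ℤ :=
  V J ω + 2 - 2 * bit J (K ω) ω - 2 * bit J (L ω) ω

/-- `W = V / 2` (an exact division, see `two_mul_W`). -/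
def W (J : Fin n → Ω → Bool) (ω : Ω) : ℤ := V J ω / 2

/-- `W' = V' / 2` (an exact division, see `two_mul_W'`). -/
def W' (J : Fin n → Ω → Bool) (K L : Ω → Fin (n + 1)) (ω : Ω) : ℤ := V' J K L ω / 2

theorem even_V (J : Fin n → Ω → Bool) (ω : Ω) : Even (V J ω) := by
  have h : V J ω = (((∑ i, (J i ω).toNat) + (decide (Odd (∑ i, (J i ω).toNat))).toNat : ℕ) : ℤ) := by
    simp [V, bit, withParity, Fin.sum_univ_castSucc]
  rw [h, Int.even_coe_nat]
  by_cases ho : Odd (∑ i, (J i ω).toNat)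
  · simp [ho, ho.add_odd odd_one]
  · simpa [ho] using Nat.not_odd_iff_even.mp ho

theorem two_mul_W (J : Fin n → Ω → Bool) (ω : Ω) : 2 * W J ω = V J ω :=
  Int.two_mul_ediv_two_of_even (even_V J ω)

theorem two_mul_W' (J : Fin n → Ω → Bool) (K L : Ω → Fin (n + 1)) (ω : Ω) :
    2 * W' J K L ω = V' J K L ω := by
  have := two_mul_W J ω
  unfold W' V'
  omega

/-- `J₁, …, Jₙ` are independent `Be(1/2)` random indicators under `P`, and the pair of random
indices `(K, L)` is independent of them and uniformly distributed over the `n (n + 1)` ordered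
pairs of distinct elements of the index set of `J₁, …, Jₙ₊₁`. -/
structure IsParityModel [MeasurableSpace Ω] (P : Measure Ω) (J : Fin n → Ω → Bool)
    (K L : Ω → Fin (n + 1)) : Prop where
  measurable_J : ∀ i, Measurable (J i)
  measurable_K : Measurable K
  measurable_L : Measurable L
  prob_J : ∀ i, P {ω | J i ω = true} = 1 / 2
  indep_J : iIndepFun J P
  law_KL : ∀ k l, P {ω | K ω = k ∧ L ω = l} =
    if k = l then 0 else 1 / ((n : ENNReal) * ((n : ENNReal) + 1))
  indep_JKL : IndepFun (fun ω i => J i ω) (fun ω => (K ω, L ω)) P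

end Model

end ParityProblem

open ParityProblem

/-! Appending the parity bit turns a uniform string of n bits into a uniform even string of n + 1
bits. Flipping two distinct positions is an involution on even strings, so the flip is reversible
for the uniform law, and `W` and `W'` are half the numbers of ones before and after it. Counting
ordered pairs of equal bits shows that, given `W = k`, the jumps up and down have probabilities
`upRate n k` and `downRate n k`, quadratics in k whose difference is -4/(n+1) · (k - μ). This is the
linear regression with R = 0 and λ = 4/(n+1).

Reversibility (`integral_upRate_mul`) combined with this drift gives the exact identity λ E[(W - μ)
g(W)] = E[S (g(W+1) - g(W))]. Inserting a shifted solution g of the Poisson Stein equation compares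
W with the translated Poisson law. The main error is E[(S - E S) Δg(W)] / λ. The other two errors,
from the fractional part γ and from the values of W below the translation, cost 1/σ² each
(`exists_steinIncrement`). Cauchy–Schwarz then gives the bounds: |Δg| ≤ 1/σ² for total variation,
and in addition Σ |Δg| ≤ 2/σ² for point masses. A smaller λ only weakens them.

The identity with g(k) = k - μ determines σ² for n ≥ 2. The bound on Var S holds because `upRate` is
Lipschitz on the range of W. The local rate 1/n needs more than Cauchy–Schwarz: detailed balance
makes the law of W unimodal, so P[W = k] |k - μ| ≤ 1 and hence P[W = k] |S(k) - E S| = O(1/n)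
pointwise, which is then summed against |Δg|. -/

/-! ### Stein's equation for the Poisson distribution -/

/-- The probability mass function of the Poisson distribution with mean `r`. -/
noncomputable def poissonWeight (r : ℝ) (k : ℕ) : ℝ := Real.exp (-r) * r ^ k / k.factorial

theorem poissonWeight_pos {r : ℝ} (hr : 0 < r) (k : ℕ) : 0 < poissonWeight r k := by
  unfold poissonWeight; positivity

theorem poissonWeight_succ (r : ℝ) (k : ℕ) :
    ((k : ℝ) + 1) * poissonWeight r (k + 1) = r * poissonWeight r k := by
  unfold poissonWeight
  rw [Nat.factorial_succ]
  push_cast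
  field_simp
  ring

theorem hasSum_poissonWeight {r : ℝ} (hr : 0 < r) : HasSum (poissonWeight r) 1 := by
  have := hasSum_one_poissonMeasure r.toNNReal
  rwa [Real.coe_toNNReal _ hr.le] at this

/-- The mass that the Poisson distribution gives to `{0, …, k - 1}`. -/
noncomputable def poissonHead (r : ℝ) (k : ℕ) : ℝ := ∑ i ∈ Finset.range k, poissonWeight r i

theorem poissonHead_succ (r : ℝ) (k : ℕ) :
    poissonHead r (k + 1) = poissonHead r k + poissonWeight r k :=
  Finset.sum_range_succ _ _

theorem poissonHead_nonneg {r : ℝ} (hr : 0 < r) (k : ℕ) : 0 ≤ poissonHead r k :=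
  Finset.sum_nonneg fun i _ => (poissonWeight_pos hr i).le

theorem one_sub_poissonHead {r : ℝ} (hr : 0 < r) (k : ℕ) :
    1 - poissonHead r k = ∑' i, poissonWeight r (i + k) := by
  have h := (hasSum_poissonWeight hr).summable.sum_add_tsum_nat_add k
  rw [(hasSum_poissonWeight hr).tsum_eq] at h
  unfold poissonHead
  linarith

/-- Termwise, r p(i) = (i + 1) p(i + 1) ≤ k p(i + 1) for i < k; the unmatched term p(0) on the right
is dropped. The tail version below uses the reverse inequality k ≤ i + k + 1. -/
theorem mul_poissonHead_le {r : ℝ} (hr : 0 < r) (k : ℕ) :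
    r * poissonHead r k ≤ k * poissonHead r (k + 1) := by
  have h : poissonHead r (k + 1) =
      ∑ i ∈ Finset.range k, poissonWeight r (i + 1) + poissonWeight r 0 :=
    Finset.sum_range_succ' _ _
  rw [h, poissonHead, Finset.mul_sum, mul_add, Finset.mul_sum]
  have h0 : 0 ≤ (k : ℝ) * poissonWeight r 0 := by
    have := poissonWeight_pos hr 0
    positivity
  refine le_add_of_le_of_nonneg (Finset.sum_le_sum fun i hi => ?_) h0
  rw [← poissonWeight_succ]
  have : (i : ℝ) + 1 ≤ k := by exact_mod_cast Finset.mem_range.mp hi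
  exact mul_le_mul_of_nonneg_right this (poissonWeight_pos hr _).le

theorem mul_one_sub_poissonHead_le {r : ℝ} (hr : 0 < r) (k : ℕ) :
    k * (1 - poissonHead r (k + 1)) ≤ r * (1 - poissonHead r k) := by
  have hs := (hasSum_poissonWeight hr).summable
  rw [one_sub_poissonHead hr, one_sub_poissonHead hr, ← tsum_mul_left, ← tsum_mul_left]
  refine Summable.tsum_le_tsum (fun i => ?_) (((summable_nat_add_iff (k + 1)).mpr hs).mul_left _)
    (((summable_nat_add_iff k).mpr hs).mul_left _)
  rw [← poissonWeight_succ, show i + (k + 1) = i + k + 1 by ring]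
  have : (k : ℝ) ≤ ((i + k : ℕ) : ℝ) + 1 := by push_cast; linarith [(i.cast_nonneg : (0 : ℝ) ≤ i)]
  exact mul_le_mul_of_nonneg_right this (poissonWeight_pos hr _).le

/-- The mass that the Poisson distribution gives to `A`. -/
noncomputable def poissonMass (r : ℝ) (A : Set ℕ) : ℝ := ∑' i, A.indicator (poissonWeight r) i

/-- The mass that the Poisson distribution gives to `A ∩ {0, …, k - 1}`. -/
noncomputable def poissonPartial (r : ℝ) (A : Set ℕ) (k : ℕ) : ℝ :=
  ∑ i ∈ Finset.range k, A.indicator (poissonWeight r) i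

theorem indicator_poissonWeight_nonneg {r : ℝ} (hr : 0 < r) (A : Set ℕ) (i : ℕ) :
    0 ≤ A.indicator (poissonWeight r) i :=
  Set.indicator_nonneg (fun i _ => (poissonWeight_pos hr i).le) i

theorem summable_indicator_poissonWeight {r : ℝ} (hr : 0 < r) (A : Set ℕ) :
    Summable (A.indicator (poissonWeight r)) :=
  (hasSum_poissonWeight hr).summable.indicator A

theorem poissonPartial_succ (r : ℝ) (A : Set ℕ) (k : ℕ) :
    poissonPartial r A (k + 1) = poissonPartial r A k + A.indicator (poissonWeight r) k :=
  Finset.sum_range_succ _ _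

theorem poissonPartial_nonneg {r : ℝ} (hr : 0 < r) (A : Set ℕ) (k : ℕ) :
    0 ≤ poissonPartial r A k :=
  Finset.sum_nonneg fun i _ => indicator_poissonWeight_nonneg hr A i

theorem poissonPartial_le_poissonMass {r : ℝ} (hr : 0 < r) (A : Set ℕ) (k : ℕ) :
    poissonPartial r A k ≤ poissonMass r A :=
  (summable_indicator_poissonWeight hr A).sum_le_tsum _
    fun i _ => indicator_poissonWeight_nonneg hr A i

theorem poissonPartial_compl (r : ℝ) (A : Set ℕ) (k : ℕ) :
    poissonPartial r Aᶜ k = poissonHead r k - poissonPartial r A k := by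
  rw [poissonPartial, poissonHead, poissonPartial, ← Finset.sum_sub_distrib]
  refine Finset.sum_congr rfl fun i _ => ?_
  rw [Set.indicator_compl, Pi.sub_apply]

theorem poissonMass_nonneg {r : ℝ} (hr : 0 < r) (A : Set ℕ) : 0 ≤ poissonMass r A :=
  tsum_nonneg fun i => indicator_poissonWeight_nonneg hr A i

theorem poissonMass_compl {r : ℝ} (hr : 0 < r) (A : Set ℕ) :
    poissonMass r Aᶜ = 1 - poissonMass r A := by
  rw [poissonMass, Set.indicator_compl, poissonMass, ← (hasSum_poissonWeight hr).tsum_eq]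
  exact (hasSum_poissonWeight hr).summable.tsum_sub (summable_indicator_poissonWeight hr A)

theorem poissonMass_le_one {r : ℝ} (hr : 0 < r) (A : Set ℕ) : poissonMass r A ≤ 1 := by
  have h := poissonMass_nonneg hr Aᶜ
  rw [poissonMass_compl hr] at h
  linarith

/-- The solution, vanishing at `0`, of Stein's equation
`r f(k + 1) - k f(k) = 1_A(k) - Po(r)(A)`. -/
noncomputable def poissonSteinSol (r : ℝ) (A : Set ℕ) (k : ℕ) : ℝ :=
  (poissonPartial r A k - poissonMass r A * poissonHead r k) / (k * poissonWeight r k)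

theorem poissonSteinSol_zero (r : ℝ) (A : Set ℕ) : poissonSteinSol r A 0 = 0 := by
  simp [poissonSteinSol]

theorem poissonSteinSol_succ (r : ℝ) (A : Set ℕ) (k : ℕ) :
    poissonSteinSol r A (k + 1) =
      (poissonPartial r A k + A.indicator (poissonWeight r) k
        - poissonMass r A * (poissonHead r k + poissonWeight r k)) / (r * poissonWeight r k) := by
  rw [poissonSteinSol, Nat.cast_succ, poissonWeight_succ, poissonPartial_succ, poissonHead_succ]

theorem poisson_stein_equation {r : ℝ} (hr : 0 < r) (A : Set ℕ) (k : ℕ) :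
    r * poissonSteinSol r A (k + 1) - k * poissonSteinSol r A k =
      A.indicator 1 k - poissonMass r A := by
  have hp := poissonWeight_pos hr k
  have hb : A.indicator (poissonWeight r) k = A.indicator 1 k * poissonWeight r k := by
    by_cases h : k ∈ A <;> simp [h]
  rw [poissonSteinSol_succ, hb]
  rcases Nat.eq_zero_or_pos k with rfl | hk
  · simp [poissonPartial, poissonHead]
    field_simp
  · have : (0 : ℝ) < k := by exact_mod_cast hk
    rw [poissonSteinSol]
    field_simp
    ring

theorem poissonSteinSol_compl {r : ℝ} (hr : 0 < r) (A : Set ℕ) (k : ℕ) :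
    poissonSteinSol r Aᶜ k = -poissonSteinSol r A k := by
  rw [poissonSteinSol, poissonSteinSol, poissonPartial_compl, poissonMass_compl hr, ← neg_div]
  congr 1
  ring

/-- The increment of the Stein solution, up to a nonpositive term, comes from the mass of `A`
at the point `k` itself. -/
theorem poissonSteinSol_succ_sub_le {r : ℝ} (hr : 0 < r) (A : Set ℕ) (k : ℕ) :
    poissonSteinSol r A (k + 1) - poissonSteinSol r A k ≤ A.indicator 1 k / r := by
  have hp := poissonWeight_pos hr k
  have hI := mul_poissonHead_le hr k
  have hT := mul_one_sub_poissonHead_le hr k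
  rw [poissonHead_succ] at hI hT
  have hc : 0 ≤ poissonMass r A - poissonPartial r A k - A.indicator (poissonWeight r) k := by
    have := poissonPartial_le_poissonMass hr A (k + 1)
    rw [poissonPartial_succ] at this
    linarith
  have ha := poissonPartial_nonneg hr A k
  have hF := poissonHead_nonneg hr k
  have hb : A.indicator (poissonWeight r) k = A.indicator 1 k * poissonWeight r k := by
    by_cases h : k ∈ A <;> simp [h]
  have hi : (0 : ℝ) ≤ A.indicator 1 k := Set.indicator_nonneg (by simp) k
  rw [poissonSteinSol_succ]
  rw [hb] at hc ⊢
  set a := poissonPartial r A k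
  set α := poissonMass r A
  set F := poissonHead r k with hFdef
  set p := poissonWeight r k
  set e : ℝ := A.indicator 1 k
  rcases Nat.eq_zero_or_pos k with rfl | hk
  · have ha0 : a = 0 := by simp [a, poissonPartial]
    have hF0 : F = 0 := by simp [F, poissonHead]
    rw [poissonSteinSol_zero, ha0, hF0, sub_zero, div_le_div_iff₀ (by positivity) hr]
    have := mul_nonneg (mul_nonneg (poissonMass_nonneg hr A) hp.le) hr.le
    change 0 ≤ α * p * r at this
    nlinarith
  · have hk' : (0 : ℝ) < k := by exact_mod_cast hk
    rw [show poissonSteinSol r A k = (a - α * F) / (k * p) from rfl]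
    -- Splitting the mass α of A into its parts a below k, e * p at k, and the rest above k, the
    -- difference of the two sides is exactly the sum of the three nonnegative products `h1`, `h2`,
    -- `h3`.
    have key : k * (a + e * p - α * (F + p)) - r * (a - α * F) ≤ e * k * p := by
      have h1 := mul_nonneg ha (sub_nonneg.mpr hT)
      have h2 := mul_nonneg hc (sub_nonneg.mpr hI)
      have h3 := mul_nonneg (mul_nonneg hi hp.le) (sub_nonneg.mpr hI)
      nlinarith
    have : (a + e * p - α * (F + p)) / (r * p) - (a - α * F) / (k * p) =
        (k * (a + e * p - α * (F + p)) - r * (a - α * F)) / (r * k * p) := by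
      field_simp
    rw [this, div_le_div_iff₀ (by positivity) hr]
    nlinarith

/-- Passing to the complement changes the sign of the solution, so the one-sided bound for both sets
is two-sided. -/
theorem abs_poissonSteinSol_succ_sub_le {r : ℝ} (hr : 0 < r) (A : Set ℕ) (k : ℕ) :
    |poissonSteinSol r A (k + 1) - poissonSteinSol r A k| ≤ 1 / r := by
  have h1 := poissonSteinSol_succ_sub_le hr A k
  have h2 := poissonSteinSol_succ_sub_le hr Aᶜ k
  rw [poissonSteinSol_compl hr, poissonSteinSol_compl hr] at h2
  have h3 : ∀ B : Set ℕ, (B.indicator 1 k : ℝ) / r ≤ 1 / r := fun B =>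
    div_le_div_of_nonneg_right (Set.indicator_le_self' (by simp) k) hr.le
  rw [abs_le]
  constructor <;> linarith [h3 A, h3 Aᶜ]

/-- Only the increment at j can be positive, and it is at most 1/r. The solution starts at 0 and is
nonnegative beyond j, so by telescoping the decreases total at most this one increase. -/
theorem sum_abs_poissonSteinSol_singleton_le {r : ℝ} (hr : 0 < r) (j M : ℕ) :
    ∑ k ∈ Finset.range M, |poissonSteinSol r {j} (k + 1) - poissonSteinSol r {j} k| ≤ 2 / r := by
  set d : ℕ → ℝ := fun k => poissonSteinSol r {j} (k + 1) - poissonSteinSol r {j} k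
  have hpt : ∀ k, |d k| ≤ 2 * (({j} : Set ℕ).indicator 1 k / r) - d k := by
    intro k
    have h1 : d k ≤ _ := poissonSteinSol_succ_sub_le hr {j} k
    have h0 : (0 : ℝ) ≤ ({j} : Set ℕ).indicator 1 k / r :=
      div_nonneg (Set.indicator_nonneg (by simp) k) hr.le
    rw [abs_le]
    constructor <;> linarith
  have hbig : ∑ k ∈ Finset.range (M + j + 1), |d k| ≤ 2 / r := by
    refine (Finset.sum_le_sum fun k _ => hpt k).trans ?_
    rw [Finset.sum_sub_distrib, Finset.sum_range_sub, poissonSteinSol_zero, ← Finset.mul_sum,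
      ← Finset.sum_div]
    have h1 : ∑ k ∈ Finset.range (M + j + 1), ({j} : Set ℕ).indicator (1 : ℕ → ℝ) k = 1 := by
      rw [Finset.sum_eq_single j]
      · simp
      · intro b _ hb
        simp [hb]
      · intro h
        exact absurd (Finset.mem_range.mpr (by omega)) h
    have hmass : poissonMass r {j} = poissonWeight r j := by
      rw [poissonMass, tsum_eq_single j]
      · simp
      · intro b hb
        simp [hb]
    have hpart : poissonPartial r {j} (M + j + 1) = poissonWeight r j := by
      rw [poissonPartial, Finset.sum_eq_single j]
      · simp
      · intro b _ hb
        simp [hb]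
      · intro h
        exact absurd (Finset.mem_range.mpr (by omega)) h
    have hF : poissonHead r (M + j + 1) ≤ 1 :=
      ((hasSum_poissonWeight hr).summable.sum_le_tsum _
        fun i _ => (poissonWeight_pos hr i).le).trans_eq (hasSum_poissonWeight hr).tsum_eq
    have hpos : 0 ≤ poissonSteinSol r {j} (M + j + 1) := by
      rw [poissonSteinSol, hmass, hpart]
      have := poissonWeight_pos hr j
      have := poissonWeight_pos hr (M + j + 1)
      refine div_nonneg ?_ (by positivity)
      nlinarith
    rw [h1, mul_one_div]
    linarith
  exact (Finset.sum_le_sum_of_subset_of_nonneg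
    (Finset.range_mono (by omega)) fun _ _ _ => abs_nonneg _).trans hbig

/-! ### Translated Poisson approximation of finitely supported laws on the integers -/

theorem poissonMeasure_real_eq_poissonMass {r : ℝ} (hr : 0 < r) (A : Set ℕ) :
    (poissonMeasure r.toNNReal).real A = poissonMass r A := by
  rw [← integral_indicator_one (MeasurableSet.of_discrete (s := A)), integral_poissonMeasure,
    poissonMass]
  refine tsum_congr fun i => ?_
  rw [Real.coe_toNNReal _ hr.le, smul_eq_mul]
  by_cases h : i ∈ A <;> simp [h, poissonWeight]

theorem translatedPoisson_real {μ σ2 : ℝ} (hσ : 0 < σ2) (A : Set ℤ) :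
    (translatedPoisson μ σ2).real A =
      poissonMass (σ2 + Int.fract (μ - σ2)) {i : ℕ | (i : ℤ) + ⌊μ - σ2⌋ ∈ A} := by
  have hr : 0 < σ2 + Int.fract (μ - σ2) := add_pos_of_pos_of_nonneg hσ (Int.fract_nonneg _)
  rw [translatedPoisson, map_measureReal_apply .of_discrete .of_discrete,
    poissonMeasure_real_eq_poissonMass hr]
  rfl

/-- The increment at `k` of the Stein solution, shifted by `t` and extended by `0`. -/
noncomputable def shiftedSteinIncrement (r : ℝ) (A : Set ℕ) (t k : ℤ) : ℝ :=
  poissonSteinSol r A (k + 1 - t).toNat - poissonSteinSol r A (k - t).toNat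

/-- For k < t also k + 1 ≤ t, so both arguments truncate to 0. -/
theorem shiftedSteinIncrement_of_lt (r : ℝ) (A : Set ℕ) {t k : ℤ} (h : k < t) :
    shiftedSteinIncrement r A t k = 0 := by
  rw [shiftedSteinIncrement, Int.toNat_of_nonpos (by omega), Int.toNat_of_nonpos (by omega),
    sub_self]

theorem shiftedSteinIncrement_add (r : ℝ) (A : Set ℕ) (t : ℤ) (m : ℕ) :
    shiftedSteinIncrement r A t (m + t) = poissonSteinSol r A (m + 1) - poissonSteinSol r A m := by
  rw [shiftedSteinIncrement, show (m : ℤ) + t + 1 - t = ((m + 1 : ℕ) : ℤ) by push_cast; ring,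
    add_sub_cancel_right, Int.toNat_natCast, Int.toNat_natCast]

theorem abs_shiftedSteinIncrement_le {r : ℝ} (hr : 0 < r) (A : Set ℕ) (t k : ℤ) :
    |shiftedSteinIncrement r A t k| ≤ 1 / r := by
  rcases lt_or_ge k t with h | h
  · rw [shiftedSteinIncrement_of_lt r A h, abs_zero]
    positivity
  · obtain ⟨m, hm⟩ := Int.eq_ofNat_of_zero_le (sub_nonneg.mpr h)
    obtain rfl : k = m + t := by omega
    rw [shiftedSteinIncrement_add]
    exact abs_poissonSteinSol_succ_sub_le hr A m

theorem sum_abs_shiftedSteinIncrement_le {r : ℝ} (hr : 0 < r) {A : Set ℕ} (hA : A.Subsingleton)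
    (t : ℤ) (F : Finset ℤ) : ∑ k ∈ F, |shiftedSteinIncrement r A t k| ≤ 2 / r := by
  rcases hA.eq_empty_or_singleton with rfl | ⟨j, rfl⟩
  -- The empty case is needed: a single integer below the translation has no preimage in ℕ.
  · have h : ∀ k, shiftedSteinIncrement r ∅ t k = 0 := by
      intro k
      simp [shiftedSteinIncrement, poissonSteinSol, poissonPartial, poissonMass]
    simp only [h, abs_zero, Finset.sum_const_zero]
    positivity
  · obtain ⟨M, hM⟩ : ∃ M : ℕ, ∀ k ∈ F, (k - t).toNat < M :=
      ⟨F.sup (fun k => (k - t).toNat) + 1, fun k hk =>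
        Nat.lt_succ_of_le (Finset.le_sup (f := fun k => (k - t).toNat) hk)⟩
    have h1 : ∑ k ∈ F, |shiftedSteinIncrement r {j} t k| =
        ∑ k ∈ F with t ≤ k, |shiftedSteinIncrement r {j} t k| := by
      rw [Finset.sum_filter]
      refine Finset.sum_congr rfl fun k _ => ?_
      split_ifs with h
      · rfl
      · rw [shiftedSteinIncrement_of_lt _ _ (not_le.mp h), abs_zero]
    have h2 : (F.filter (t ≤ ·)) ⊆ (Finset.range M).image (fun m : ℕ => (m : ℤ) + t) := by
      intro k hk
      rw [Finset.mem_filter] at hk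
      rw [Finset.mem_image]
      exact ⟨(k - t).toNat, Finset.mem_range.mpr (hM k hk.1), by omega⟩
    rw [h1]
    refine (Finset.sum_le_sum_of_subset_of_nonneg h2 fun _ _ _ => abs_nonneg _).trans ?_
    rw [Finset.sum_image (by intro a _ b _ h; simpa using h)]
    simp only [shiftedSteinIncrement_add]
    exact sum_abs_poissonSteinSol_singleton_le hr j M

/-- Stein's method for a law `q` on a finite set `B` of integers that satisfies the identity
`λ 𝔼[(X - μ) g(X)] = 𝔼[s(X) (g(X + 1) - g(X))]`. -/
theorem exists_steinIncrement (B : Finset ℤ) (q s : ℤ → ℝ) (hq : ∀ k, 0 ≤ q k)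
    (hq1 : ∑ k ∈ B, q k = 1) {μ σ2 lam : ℝ}
    (hσ : ∑ k ∈ B, q k * ((k : ℝ) - μ) ^ 2 = σ2) (hσ0 : 0 < σ2) (hlam : 0 < lam)
    (hst : ∀ g : ℤ → ℝ, lam * ∑ k ∈ B, q k * (((k : ℝ) - μ) * g k) =
      ∑ k ∈ B, q k * (s k * (g (k + 1) - g k)))
    (A : Set ℤ) :
    ∃ d : ℤ → ℝ, (∀ k, |d k| ≤ 1 / σ2) ∧
      (A.Subsingleton → ∀ F : Finset ℤ, ∑ k ∈ F, |d k| ≤ 2 / σ2) ∧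
      |∑ k ∈ B, q k * A.indicator 1 k - (translatedPoisson μ σ2).real A| ≤
        |∑ k ∈ B, q k * ((s k - ∑ k ∈ B, q k * s k) * d k)| / lam + 2 / σ2 := by
  set γ := Int.fract (μ - σ2) with hγ
  set t := ⌊μ - σ2⌋ with ht
  have hγ0 : 0 ≤ γ := Int.fract_nonneg _
  have hγ1 : γ ≤ 1 := (Int.fract_lt_one _).le
  have htγ : (t : ℝ) + γ = μ - σ2 := Int.floor_add_fract _
  set r := σ2 + γ with hrdef
  have hr : 0 < r := add_pos_of_pos_of_nonneg hσ0 hγ0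
  have hrσ : 1 / r ≤ 1 / σ2 := one_div_le_one_div_of_le hσ0 (by linarith)
  set A' : Set ℕ := {i : ℕ | (i : ℤ) + t ∈ A} with hA'
  set d := shiftedSteinIncrement r A' t with hd
  have hd1 : ∀ k, |d k| ≤ 1 / σ2 := fun k => (abs_shiftedSteinIncrement_le hr A' t k).trans hrσ
  refine ⟨d, hd1, fun hA F => ?_, ?_⟩
  · have hsub : A'.Subsingleton := fun i hi j hj => by
      have := hA hi hj
      omega
    refine (sum_abs_shiftedSteinIncrement_le hr hsub t F).trans ?_
    calc 2 / r = 2 * (1 / r) := by ring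
      _ ≤ 2 * (1 / σ2) := by linarith
      _ = 2 / σ2 := by ring
  · set g : ℤ → ℝ := fun k => poissonSteinSol r A' (k - t).toNat with hg
    have hdg : ∀ k, d k = g (k + 1) - g k := fun k => rfl
    set m := (translatedPoisson μ σ2).real A with hm
    have hm' : m = poissonMass r A' := translatedPoisson_real hσ0 A
    have hm0 : 0 ≤ m := hm' ▸ poissonMass_nonneg hr A'
    have hm1 : m ≤ 1 := hm' ▸ poissonMass_le_one hr A'
    set e : ℤ → ℝ := fun k => A.indicator 1 k - m - (r * d k - ((k : ℝ) - μ) * g k) with he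
    -- The Stein equation fails only for k < t, where the error is at most 1. There μ - k > μ - t =
    -- σ2 + γ ≥ σ2, so a Chebyshev weight dominates it, with mean σ2 / σ2 ^ 2 = 1 / σ2.
    have hebound : ∀ k, |e k| ≤ ((k : ℝ) - μ) ^ 2 / σ2 ^ 2 := by
      intro k
      rcases lt_or_ge k t with h | h
      · have h0 : g k = 0 := by
          rw [hg]
          simp only
          rw [Int.toNat_of_nonpos (by omega), poissonSteinSol_zero]
        have hek : e k = A.indicator 1 k - m := by
          rw [he]
          simp only
          rw [h0, hd, shiftedSteinIncrement_of_lt _ _ h]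
          ring
        have hek1 : |e k| ≤ 1 := by
          rw [hek, abs_le]
          have h1 : (0 : ℝ) ≤ A.indicator 1 k := Set.indicator_nonneg (by simp) k
          have h2 : A.indicator (1 : ℤ → ℝ) k ≤ 1 := Set.indicator_le_self' (by simp) k
          constructor <;> linarith
        refine hek1.trans ?_
        rw [le_div_iff₀ (by positivity), one_mul]
        have : (k : ℝ) < t := by exact_mod_cast h
        nlinarith
      · have hek : e k = 0 := by
          obtain ⟨i, hi⟩ := Int.eq_ofNat_of_zero_le (sub_nonneg.mpr h)
          obtain rfl : k = i + t := by omega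
          have hst := poisson_stein_equation hr A' i
          have hgi : g (i + t) = poissonSteinSol r A' i := by
            rw [hg]
            simp
          have hind : A.indicator (1 : ℤ → ℝ) (i + t) = A'.indicator 1 i := by
            by_cases hmem : (i : ℤ) + t ∈ A <;> simp [hmem, hA']
          rw [he]
          simp only
          rw [hind, hgi, hm', hd, shiftedSteinIncrement_add]
          push_cast
          have : (i : ℝ) + t - μ = i - r := by rw [hrdef]; linarith
          rw [this]
          linarith
        rw [hek, abs_zero]
        positivity
    have hsumE : |∑ k ∈ B, q k * e k| ≤ 1 / σ2 := by
      calc |∑ k ∈ B, q k * e k| ≤ ∑ k ∈ B, |q k * e k| := Finset.abs_sum_le_sum_abs _ _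
        _ ≤ ∑ k ∈ B, (q k * ((k : ℝ) - μ) ^ 2) / σ2 ^ 2 := by
          refine Finset.sum_le_sum fun k _ => ?_
          rw [abs_mul, abs_of_nonneg (hq k), mul_div_assoc]
          exact mul_le_mul_of_nonneg_left (hebound k) (hq k)
        _ = 1 / σ2 := by
          rw [← Finset.sum_div, hσ]
          field_simp
    have hsumD : |γ * ∑ k ∈ B, q k * d k| ≤ 1 / σ2 := by
      rw [abs_mul, abs_of_nonneg hγ0]
      have h1 : |∑ k ∈ B, q k * d k| ≤ 1 / σ2 := by
        calc |∑ k ∈ B, q k * d k| ≤ ∑ k ∈ B, |q k * d k| := Finset.abs_sum_le_sum_abs _ _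
          _ ≤ ∑ k ∈ B, q k * (1 / σ2) := by
            refine Finset.sum_le_sum fun k _ => ?_
            rw [abs_mul, abs_of_nonneg (hq k)]
            exact mul_le_mul_of_nonneg_left (hd1 k) (hq k)
          _ = 1 / σ2 := by rw [← Finset.sum_mul, hq1, one_mul]
      calc γ * |∑ k ∈ B, q k * d k| ≤ 1 * |∑ k ∈ B, q k * d k| :=
            mul_le_mul_of_nonneg_right hγ1 (abs_nonneg _)
        _ ≤ 1 / σ2 := by rwa [one_mul]
    set Es := ∑ k ∈ B, q k * s k with hEs
    -- The identity with g(k) = k - μ, all of whose increments are 1.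
    have hEsv : Es = lam * σ2 := by
      have h := hst fun k => (k : ℝ) - μ
      have h2 : ∑ k ∈ B, q k * (s k * ((((k + 1 : ℤ) : ℝ) - μ) - ((k : ℝ) - μ))) = Es :=
        Finset.sum_congr rfl fun k _ => by push_cast; ring
      rw [h2] at h
      rw [← h, ← hσ]
      congr 1
      exact Finset.sum_congr rfl fun k _ => by ring
    have hT : ∑ k ∈ B, q k * (((k : ℝ) - μ) * g k) =
        σ2 * ∑ k ∈ B, q k * d k + (∑ k ∈ B, q k * ((s k - Es) * d k)) / lam := by
      have h := hst g
      have h2 : ∑ k ∈ B, q k * ((s k - Es) * d k) =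
          ∑ k ∈ B, q k * (s k * (g (k + 1) - g k)) - Es * ∑ k ∈ B, q k * d k := by
        rw [Finset.mul_sum, ← Finset.sum_sub_distrib]
        exact Finset.sum_congr rfl fun k _ => by rw [hdg]; ring
      rw [h2, ← h, hEsv]
      field_simp
      ring
    have hmain : ∑ k ∈ B, q k * A.indicator 1 k - m =
        γ * ∑ k ∈ B, q k * d k - (∑ k ∈ B, q k * ((s k - Es) * d k)) / lam
          + ∑ k ∈ B, q k * e k := by
      have h1 : ∑ k ∈ B, q k * e k = ∑ k ∈ B, q k * A.indicator 1 k - m -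
          (r * ∑ k ∈ B, q k * d k - ∑ k ∈ B, q k * (((k : ℝ) - μ) * g k)) := by
        have : m = ∑ k ∈ B, q k * m := by rw [← Finset.sum_mul, hq1, one_mul]
        rw [Finset.mul_sum]
        conv_rhs => rw [this]
        rw [← Finset.sum_sub_distrib, ← Finset.sum_sub_distrib, ← Finset.sum_sub_distrib]
        exact Finset.sum_congr rfl fun k _ => by rw [he]; ring
      rw [h1, hT, hrdef]
      ring
    rw [hmain]
    have h3 : |(∑ k ∈ B, q k * ((s k - Es) * d k)) / lam| =
        |∑ k ∈ B, q k * ((s k - Es) * d k)| / lam := by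
      rw [abs_div, abs_of_pos hlam]
    rw [← h3]
    refine (abs_add_le _ _).trans ?_
    have h4 := abs_sub (γ * ∑ k ∈ B, q k * d k) ((∑ k ∈ B, q k * ((s k - Es) * d k)) / lam)
    have h5 : 2 / σ2 = 1 / σ2 + 1 / σ2 := by ring
    linarith

/-! ### Even binary strings -/

/-- The number of ones of a binary string. -/
def numOnes {m : ℕ} (y : Fin m → Bool) : ℤ := ∑ j, ((y j).toNat : ℤ)

theorem even_numOnes_withParity {n : ℕ} (x : Fin n → Bool) : Even (numOnes (withParity x)) :=
  even_V (fun i (_ : Unit) => x i) ()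

/-- An even string is determined by its first n bits, so `withParity` and `Fin.init` identify all
strings of length n with the even strings of length n + 1. -/
theorem withParity_init {n : ℕ} {y : Fin (n + 1) → Bool} (hy : Even (numOnes y)) :
    withParity (Fin.init y) = y := by
  unfold withParity
  conv_rhs => rw [← Fin.snoc_init_self y]
  congr 1
  have h : numOnes y = ((∑ i, (Fin.init y i).toNat : ℕ) : ℤ) + ((y (Fin.last n)).toNat : ℤ) := by
    rw [numOnes, Fin.sum_univ_castSucc]
    push_cast
    rfl
  rw [h] at hy
  cases hb : y (Fin.last n)
  · rw [hb] at hy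
    have : Even (∑ i, (Fin.init y i).toNat) := by
      rw [← Int.even_coe_nat]
      simpa using hy
    simpa using this
  · rw [hb] at hy
    have : ¬ Even (∑ i, (Fin.init y i).toNat) := by
      rw [← Int.even_coe_nat]
      have h1 : Even (((∑ i, (Fin.init y i).toNat : ℕ) : ℤ) + 1) := by simpa using hy
      rwa [Int.even_add_one] at h1
    simpa using this

/-- The string `y` with the bits at `k` and `l` flipped. -/
def flipTwo {m : ℕ} (k l : Fin m) (y : Fin m → Bool) (j : Fin m) : Bool :=
  if j = k ∨ j = l then !y j else y j

theorem flipTwo_flipTwo {m : ℕ} (k l : Fin m) (y : Fin m → Bool) :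
    flipTwo k l (flipTwo k l y) = y := by
  funext j
  unfold flipTwo
  split_ifs <;> simp

theorem numOnes_flipTwo {m : ℕ} {k l : Fin m} (hkl : k ≠ l) (y : Fin m → Bool) :
    numOnes (flipTwo k l y) =
      numOnes y + 2 - 2 * ((y k).toNat : ℤ) - 2 * ((y l).toNat : ℤ) := by
  have h : ∀ j, ((flipTwo k l y j).toNat : ℤ) = ((y j).toNat : ℤ)
      + (if j = k then 1 - 2 * ((y k).toNat : ℤ) else 0)
      + (if j = l then 1 - 2 * ((y l).toNat : ℤ) else 0) := by
    intro j
    unfold flipTwo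
    by_cases h1 : j = k
    · subst h1
      rw [if_pos (Or.inl rfl), if_pos rfl, if_neg hkl]
      cases y j <;> simp
    · by_cases h2 : j = l
      · subst h2
        rw [if_pos (Or.inr rfl), if_neg h1, if_pos rfl]
        cases y j <;> simp
      · simp [h1, h2]
  rw [numOnes, Finset.sum_congr rfl fun j _ => h j, Finset.sum_add_distrib,
    Finset.sum_add_distrib, Finset.sum_ite_eq' Finset.univ k, Finset.sum_ite_eq' Finset.univ l]
  simp only [Finset.mem_univ, if_true, numOnes]
  ring

theorem withParity_init_flipTwo {n : ℕ} {k l : Fin (n + 1)} (hkl : k ≠ l) (x : Fin n → Bool) :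
    withParity (Fin.init (flipTwo k l (withParity x))) = flipTwo k l (withParity x) := by
  refine withParity_init ?_
  rw [numOnes_flipTwo hkl]
  have := even_numOnes_withParity x
  rw [Int.even_iff] at this ⊢
  omega

/-- Flipping two distinct bits preserves evenness, so it transports to an involution of the strings
of length n, along which the sum is reindexed. -/
theorem sum_withParity_flipTwo {n : ℕ} {k l : Fin (n + 1)} (hkl : k ≠ l)
    (G : (Fin (n + 1) → Bool) → ℝ) :
    ∑ x : Fin n → Bool, G (flipTwo k l (withParity x)) = ∑ x : Fin n → Bool, G (withParity x) := by
  have hinv : Function.Involutive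
      (fun x : Fin n → Bool => (Fin.init (flipTwo k l (withParity x)) : Fin n → Bool)) := by
    intro x
    simp only
    rw [withParity_init_flipTwo hkl, flipTwo_flipTwo]
    funext i
    simp [withParity, Fin.init]
  rw [← Equiv.sum_comp hinv.toPerm]
  refine Finset.sum_congr rfl fun x _ => ?_
  rw [Function.Involutive.coe_toPerm, withParity_init_flipTwo hkl, flipTwo_flipTwo]

/-- The full square minus its diagonal. For bits, the diagonal squares are the bits themselves,
which yields the counts of ordered pairs below. -/
theorem sum_ne_mul {m : ℕ} (a : Fin m → ℝ) :
    ∑ k, ∑ l, (if k = l then 0 else a k * a l) = (∑ k, a k) ^ 2 - ∑ k, a k ^ 2 := by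
  have h : ∀ k l, (if k = l then 0 else a k * a l) =
      a k * a l - if k = l then a k * a l else 0 := by
    intro k l
    split_ifs <;> simp
  simp only [h, Finset.sum_sub_distrib, Finset.sum_ite_eq, Finset.mem_univ, if_true]
  rw [sq, Finset.sum_mul_sum]
  congr 1
  exact Finset.sum_congr rfl fun k _ => (sq (a k)).symm

theorem sum_ne_one_bits {m : ℕ} (y : Fin m → Bool) :
    ∑ k, ∑ l, (if k = l then 0 else (((y k).toNat : ℝ)) * ((y l).toNat : ℝ)) =
      (numOnes y : ℝ) * (numOnes y - 1) := by
  rw [sum_ne_mul fun k => ((y k).toNat : ℝ)]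
  have h1 : ∀ k, ((y k).toNat : ℝ) ^ 2 = (y k).toNat := by
    intro k
    cases y k <;> simp
  simp only [h1, numOnes]
  push_cast
  ring

theorem sum_ne_zero_bits {m : ℕ} (y : Fin m → Bool) :
    ∑ k, ∑ l, (if k = l then 0 else ((1 - ((y k).toNat : ℝ))) * (1 - ((y l).toNat : ℝ))) =
      ((m : ℝ) - numOnes y) * (m - numOnes y - 1) := by
  rw [sum_ne_mul fun k => 1 - ((y k).toNat : ℝ)]
  have h1 : ∀ k, (1 - ((y k).toNat : ℝ)) ^ 2 = 1 - (y k).toNat := by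
    intro k
    cases y k <;> simp
  simp only [h1, numOnes, Finset.sum_sub_distrib]
  simp
  ring

theorem numOnes_nonneg {m : ℕ} (y : Fin m → Bool) : 0 ≤ numOnes y :=
  Finset.sum_nonneg fun _ _ => Int.natCast_nonneg _

theorem numOnes_le {m : ℕ} (y : Fin m → Bool) : numOnes y ≤ m := by
  refine (Finset.sum_le_sum (g := fun _ => (1 : ℤ)) fun j _ => ?_).trans (by simp)
  cases y j <;> simp

/-! ### The law of the model -/

section Model

variable {Ω : Type*} {n : ℕ} [MeasurableSpace Ω] {P : Measure Ω} {J : Fin n → Ω → Bool}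
  {K L : Ω → Fin (n + 1)}

theorem measurable_bits (h : IsParityModel P J K L) : Measurable fun ω i => J i ω :=
  measurable_pi_lambda _ h.measurable_J

theorem measurable_bits_indices (h : IsParityModel P J K L) :
    Measurable fun ω => ((fun i => J i ω : Fin n → Bool), K ω, L ω) :=
  (measurable_bits h).prodMk (h.measurable_K.prodMk h.measurable_L)

theorem measurable_of_bits_indices (h : IsParityModel P J K L) {α : Type*} [MeasurableSpace α]
    (F : (Fin n → Bool) → Fin (n + 1) → Fin (n + 1) → α) :
    Measurable fun ω => F (fun i => J i ω) (K ω) (L ω) :=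
  (measurable_of_finite fun z : (Fin n → Bool) × Fin (n + 1) × Fin (n + 1) =>
    F z.1 z.2.1 z.2.2).comp (measurable_bits_indices h)

variable [IsProbabilityMeasure P]

theorem integrable_of_bits_indices (h : IsParityModel P J K L)
    (F : (Fin n → Bool) → Fin (n + 1) → Fin (n + 1) → ℝ) :
    Integrable (fun ω => F (fun i => J i ω) (K ω) (L ω)) P := by
  have hT := measurable_bits_indices h
  have : IsProbabilityMeasure (P.map fun ω => ((fun i => J i ω : Fin n → Bool), K ω, L ω)) :=
    Measure.isProbabilityMeasure_map hT.aemeasurable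
  exact (Integrable.of_finite (f := fun z : (Fin n → Bool) × Fin (n + 1) × Fin (n + 1) =>
    F z.1 z.2.1 z.2.2)).comp_measurable hT

theorem measureReal_bits_eq (h : IsParityModel P J K L) (x : Fin n → Bool) :
    P.real {ω | (fun i => J i ω) = x} = 1 / 2 ^ n := by
  have hhalf : ∀ i, P.real (J i ⁻¹' {x i}) = 1 / 2 := by
    intro i
    have ht : P.real (J i ⁻¹' {true}) = 1 / 2 := by
      have := h.prob_J i
      change P (J i ⁻¹' {true}) = 1 / 2 at this
      rw [measureReal_def, this]
      simp
    cases x i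
    · have hc : J i ⁻¹' {false} = (J i ⁻¹' {true})ᶜ := by
        ext ω
        simp
      rw [hc, probReal_compl_eq_one_sub (h.measurable_J i (measurableSet_singleton _)), ht]
      norm_num
    · exact ht
  have hset : {ω | (fun i => J i ω) = x} = ⋂ i ∈ Finset.univ, J i ⁻¹' {x i} := by
    ext ω
    simp [funext_iff]
  rw [hset, measureReal_def, h.indep_J.measure_inter_preimage_eq_mul Finset.univ
    (fun i _ => measurableSet_singleton (x i)), ENNReal.toReal_prod]
  change ∏ i, P.real (J i ⁻¹' {x i}) = _
  simp [hhalf]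

theorem integral_bits_indices (h : IsParityModel P J K L)
    (F : (Fin n → Bool) → Fin (n + 1) → Fin (n + 1) → ℝ) :
    ∫ ω, F (fun i => J i ω) (K ω) (L ω) ∂P =
      (∑ x, ∑ k, ∑ l, if k = l then 0 else F x k l) / (2 ^ n * ((n : ℝ) * (n + 1))) := by
  have hT := measurable_bits_indices h
  have hpm : IsProbabilityMeasure (P.map fun ω => ((fun i => J i ω : Fin n → Bool), K ω, L ω)) :=
    Measure.isProbabilityMeasure_map hT.aemeasurable
  have h1 := integral_map hT.aemeasurable (μ := P)
    (f := fun z : (Fin n → Bool) × Fin (n + 1) × Fin (n + 1) => F z.1 z.2.1 z.2.2)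
    (Measurable.of_discrete).aestronglyMeasurable
  rw [← h1, integral_fintype Integrable.of_finite, Fintype.sum_prod_type]
  simp only [Fintype.sum_prod_type]
  have hpt : ∀ x k l, (P.map fun ω => ((fun i => J i ω : Fin n → Bool), K ω, L ω)).real {(x, k, l)}
      = if k = l then (0 : ℝ) else 1 / (2 ^ n * ((n : ℝ) * (n + 1))) := by
    intro x k l
    rw [map_measureReal_apply hT (measurableSet_singleton _)]
    have hset : (fun ω => ((fun i => J i ω : Fin n → Bool), K ω, L ω)) ⁻¹' {(x, k, l)} =
        (fun ω i => J i ω) ⁻¹' {x} ∩ (fun ω => (K ω, L ω)) ⁻¹' {(k, l)} := by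
      ext ω
      simp
    have hKL : P.real ((fun ω => (K ω, L ω)) ⁻¹' {(k, l)}) =
        if k = l then (0 : ℝ) else 1 / ((n : ℝ) * (n + 1)) := by
      have hkl := h.law_KL k l
      have hs : (fun ω => (K ω, L ω)) ⁻¹' {(k, l)} = {ω | K ω = k ∧ L ω = l} := by
        ext ω
        simp
      rw [hs, measureReal_def, hkl]
      split_ifs
      · simp
      · rw [ENNReal.toReal_div, ENNReal.toReal_mul,
          ENNReal.toReal_add (ENNReal.natCast_ne_top _) ENNReal.one_ne_top]
        simp
    rw [hset, measureReal_def, h.indep_JKL.measure_inter_preimage_eq_mul _ _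
      (measurableSet_singleton _) (measurableSet_singleton _), ENNReal.toReal_mul,
      ← measureReal_def, ← measureReal_def, hKL]
    have hx := measureReal_bits_eq h x
    change P.real ((fun ω i => J i ω) ⁻¹' {x}) = _ at hx
    rw [hx]
    split_ifs
    · simp
    · rw [div_mul_div_comm, one_mul]
  simp only [hpt, smul_eq_mul, Finset.sum_div]
  refine Finset.sum_congr rfl fun x _ => Finset.sum_congr rfl fun k _ =>
    Finset.sum_congr rfl fun l _ => ?_
  split_ifs
  · simp
  · ring

end Model

/-! ### Exchangeability and conditional jump probabilities -/

/-- The probability of a jump from `k` to `k + 1`. -/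
noncomputable def upRate (n : ℕ) (k : ℤ) : ℝ :=
  ((n : ℝ) + 1 - 2 * k) * ((n : ℝ) - 2 * k) / (n * (n + 1))

/-- The probability of a jump from `k` to `k - 1`. -/
noncomputable def downRate (n : ℕ) (k : ℤ) : ℝ :=
  2 * (k : ℝ) * (2 * k - 1) / (n * (n + 1))

theorem upRate_sub_downRate {n : ℕ} (hn : 1 ≤ n) (k : ℤ) :
    upRate n k - downRate n k = 1 - 4 * (k : ℝ) / (n + 1) := by
  have : (0 : ℝ) < n := by exact_mod_cast hn
  unfold upRate downRate
  field_simp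
  ring

theorem sum_ne_const_mul {m : ℕ} (c : ℝ) (F : Fin m → Fin m → ℝ) :
    ∑ k, ∑ l, (if k = l then 0 else c * F k l) = c * ∑ k, ∑ l, if k = l then 0 else F k l := by
  simp only [Finset.mul_sum]
  refine Finset.sum_congr rfl fun k _ => Finset.sum_congr rfl fun l _ => ?_
  split_ifs <;> simp

section Model

variable {Ω : Type*} {n : ℕ} {J : Fin n → Ω → Bool} {K L : Ω → Fin (n + 1)}

theorem two_mul_W_eq_numOnes (ω : Ω) : 2 * W J ω = numOnes (withParity fun i => J i ω) :=
  two_mul_W J ω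

theorem W_nonneg (ω : Ω) : 0 ≤ W J ω := by
  have := numOnes_nonneg (withParity fun i => J i ω)
  rw [← two_mul_W_eq_numOnes] at this
  omega

theorem two_mul_W_le (ω : Ω) : 2 * W J ω ≤ n + 1 := by
  rw [two_mul_W_eq_numOnes]
  exact_mod_cast numOnes_le (withParity fun i => J i ω)

theorem W_mem_Icc (ω : Ω) : W J ω ∈ Finset.Icc (0 : ℤ) (n + 1) := by
  rw [Finset.mem_Icc]
  have := W_nonneg (J := J) ω
  have := two_mul_W_le (J := J) ω
  omega

theorem W'_eq (ω : Ω) : W' J K L ω = W J ω + 1 - bit J (K ω) ω - bit J (L ω) ω := by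
  have h1 := two_mul_W J ω
  have h2 := two_mul_W' J K L ω
  unfold V' at h2
  omega

theorem bit_eq_zero_or_one (k : Fin (n + 1)) (ω : Ω) : bit J k ω = 0 ∨ bit J k ω = 1 := by
  unfold bit
  cases withParity (fun i => J i ω) k <;> simp

theorem W'_sub_W_mem (ω : Ω) : W' J K L ω - W J ω ∈ ({-1, 0, 1} : Set ℤ) := by
  rw [W'_eq]
  rcases bit_eq_zero_or_one (J := J) (K ω) ω with h1 | h1 <;>
  rcases bit_eq_zero_or_one (J := J) (L ω) ω with h2 | h2 <;> simp [h1, h2]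

theorem indicator_up_eq (ω : Ω) :
    ({ω | W' J K L ω = W J ω + 1} : Set Ω).indicator (fun _ => (1 : ℝ)) ω =
      (1 - (bit J (K ω) ω : ℝ)) * (1 - (bit J (L ω) ω : ℝ)) := by
  simp only [Set.indicator_apply, Set.mem_ofPred_eq, W'_eq]
  rcases bit_eq_zero_or_one (J := J) (K ω) ω with h1 | h1 <;>
  rcases bit_eq_zero_or_one (J := J) (L ω) ω with h2 | h2 <;> simp [h1, h2] <;> omega

theorem indicator_down_eq (ω : Ω) :
    ({ω | W J ω = W' J K L ω + 1} : Set Ω).indicator (fun _ => (1 : ℝ)) ω =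
      (bit J (K ω) ω : ℝ) * (bit J (L ω) ω : ℝ) := by
  simp only [Set.indicator_apply, Set.mem_ofPred_eq, W'_eq]
  rcases bit_eq_zero_or_one (J := J) (K ω) ω with h1 | h1 <;>
  rcases bit_eq_zero_or_one (J := J) (L ω) ω with h2 | h2 <;> simp [h1, h2] <;> omega

variable [MeasurableSpace Ω] {P : Measure Ω}

theorem measurable_W (h : IsParityModel P J K L) : Measurable (W J) :=
  measurable_of_bits_indices h fun x _ _ => numOnes (withParity x) / 2

theorem measurable_W' (h : IsParityModel P J K L) : Measurable (W' J K L) :=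
  measurable_of_bits_indices h fun x k l =>
    (numOnes (withParity x) + 2 - 2 * ((withParity x k).toNat : ℤ)
      - 2 * ((withParity x l).toNat : ℤ)) / 2

variable [IsProbabilityMeasure P]

theorem integrable_comp_W (h : IsParityModel P J K L) (g : ℤ → ℝ) :
    Integrable (fun ω => g (W J ω)) P :=
  integrable_of_bits_indices h fun x _ _ => g (numOnes (withParity x) / 2)

theorem integrable_comp_W_bit (h : IsParityModel P J K L) (φ : ℤ → ℤ → ℤ → ℝ) :
    Integrable (fun ω => φ (W J ω) (bit J (K ω) ω) (bit J (L ω) ω)) P :=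
  integrable_of_bits_indices h fun x k l =>
    φ (numOnes (withParity x) / 2) (withParity x k).toNat (withParity x l).toNat

/-- For each fixed pair of distinct indices the flip exchanges the strings before and after the
move, hence the roles of `W` and `W'`. -/
theorem integral_pair_swap (h : IsParityModel P J K L) (φ : ℤ → ℤ → ℝ) :
    ∫ ω, φ (W J ω) (W' J K L ω) ∂P = ∫ ω, φ (W' J K L ω) (W J ω) ∂P := by
  set v' : (Fin n → Bool) → Fin (n + 1) → Fin (n + 1) → ℤ := fun x k l =>
    numOnes (withParity x) + 2 - 2 * ((withParity x k).toNat : ℤ)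
      - 2 * ((withParity x l).toNat : ℤ) with hv'
  have h1 := integral_bits_indices h fun x k l =>
    φ (numOnes (withParity x) / 2) (v' x k l / 2)
  have h2 := integral_bits_indices h fun x k l =>
    φ (v' x k l / 2) (numOnes (withParity x) / 2)
  refine h1.trans (Eq.trans ?_ h2.symm)
  congr 1
  rw [Finset.sum_comm]
  conv_rhs => rw [Finset.sum_comm]
  refine Finset.sum_congr rfl fun k _ => ?_
  rw [Finset.sum_comm]
  conv_rhs => rw [Finset.sum_comm]
  refine Finset.sum_congr rfl fun l _ => ?_
  by_cases hkl : k = l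
  · simp [hkl]
  · simp only [if_neg hkl, hv']
    have := sum_withParity_flipTwo hkl
      fun y => φ (numOnes y / 2) (numOnes (flipTwo k l y) / 2)
    simp only [flipTwo_flipTwo, numOnes_flipTwo hkl] at this
    exact this.symm

theorem isExchangeablePair (h : IsParityModel P J K L) :
    IsExchangeablePair P (W J) (W' J K L) := by
  have hm := (measurable_W h).prodMk (measurable_W' h)
  have hm' := (measurable_W' h).prodMk (measurable_W h)
  refine Measure.ext_of_singleton fun z => ?_
  rw [Measure.map_apply hm (measurableSet_singleton z),
    Measure.map_apply hm' (measurableSet_singleton z), ← measureReal_eq_measureReal_iff,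
    ← integral_indicator_one (hm (measurableSet_singleton z)),
    ← integral_indicator_one (hm' (measurableSet_singleton z))]
  exact integral_pair_swap h fun a b => ({z} : Set (ℤ × ℤ)).indicator 1 (a, b)

/-- Averaging over the index pair with the bits held fixed: ρ is the conditional mean of F given the
bits. It is used with ρ a function of the number of ones. -/
theorem integral_eq_of_sum_indices (h : IsParityModel P J K L)
    (F : (Fin n → Bool) → Fin (n + 1) → Fin (n + 1) → ℝ) (ρ : (Fin n → Bool) → ℝ)
    (hF : ∀ x, ∑ k, ∑ l, (if k = l then 0 else F x k l) = n * (n + 1) * ρ x) :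
    ∫ ω, F (fun i => J i ω) (K ω) (L ω) ∂P = ∫ ω, ρ (fun i => J i ω) ∂P := by
  refine (integral_bits_indices h F).trans
    (Eq.trans ?_ (integral_bits_indices h fun x _ _ => ρ x).symm)
  congr 1
  refine Finset.sum_congr rfl fun x _ => ?_
  have h1 : ∀ k l : Fin (n + 1),
      (if k = l then 0 else ρ x) = ρ x * (if k = l then 0 else (1 : ℝ) * 1) := by
    intro k l
    split_ifs <;> simp
  rw [hF]
  simp only [h1, ← Finset.mul_sum]
  rw [sum_ne_mul fun _ : Fin (n + 1) => (1 : ℝ)]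
  simp
  ring

theorem integral_mul_up (hn : 1 ≤ n) (h : IsParityModel P J K L) (g : ℤ → ℝ) :
    ∫ ω, g (W J ω) * ((1 - (bit J (K ω) ω : ℝ)) * (1 - (bit J (L ω) ω : ℝ))) ∂P =
      ∫ ω, g (W J ω) * upRate n (W J ω) ∂P := by
  have hn' : (0 : ℝ) < n := by exact_mod_cast hn
  refine integral_eq_of_sum_indices h
    (fun x k l => g (numOnes (withParity x) / 2) *
      ((1 - (((withParity x k).toNat : ℤ) : ℝ)) * (1 - (((withParity x l).toNat : ℤ) : ℝ))))
    (fun x => g (numOnes (withParity x) / 2) * upRate n (numOnes (withParity x) / 2))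
    fun x => ?_
  simp only [Int.cast_natCast]
  rw [sum_ne_const_mul, sum_ne_zero_bits]
  have hx : ((numOnes (withParity x) : ℤ) : ℝ) = 2 * ((numOnes (withParity x) / 2 : ℤ) : ℝ) := by
    exact_mod_cast (Int.two_mul_ediv_two_of_even (even_numOnes_withParity x)).symm
  unfold upRate
  rw [hx]
  push_cast
  field_simp
  ring

theorem integral_mul_down (hn : 1 ≤ n) (h : IsParityModel P J K L) (g : ℤ → ℝ) :
    ∫ ω, g (W J ω) * ((bit J (K ω) ω : ℝ) * (bit J (L ω) ω : ℝ)) ∂P =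
      ∫ ω, g (W J ω) * downRate n (W J ω) ∂P := by
  have hn' : (0 : ℝ) < n := by exact_mod_cast hn
  refine integral_eq_of_sum_indices h
    (fun x k l => g (numOnes (withParity x) / 2) *
      ((((withParity x k).toNat : ℤ) : ℝ) * (((withParity x l).toNat : ℤ) : ℝ)))
    (fun x => g (numOnes (withParity x) / 2) * downRate n (numOnes (withParity x) / 2))
    fun x => ?_
  simp only [Int.cast_natCast]
  rw [sum_ne_const_mul, sum_ne_one_bits]
  have hx : ((numOnes (withParity x) : ℤ) : ℝ) = 2 * ((numOnes (withParity x) / 2 : ℤ) : ℝ) := by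
    exact_mod_cast (Int.two_mul_ediv_two_of_even (even_numOnes_withParity x)).symm
  unfold downRate
  rw [hx]
  field_simp

/-- The balance between the jumps upwards and downwards. -/
theorem integral_upRate_mul (hn : 1 ≤ n) (h : IsParityModel P J K L) (g : ℤ → ℝ) :
    ∫ ω, g (W J ω + 1) * upRate n (W J ω) ∂P = ∫ ω, g (W J ω) * downRate n (W J ω) ∂P := by
  rw [← integral_mul_up hn h fun k => g (k + 1), ← integral_mul_down hn h]
  simp only [← indicator_up_eq, ← indicator_down_eq]
  -- The test function carries the up-jump event. The swap turns it into the down-jump event, on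
  -- which W' + 1 = W.
  have := integral_pair_swap h fun a b => g (a + 1) * if b = a + 1 then 1 else 0
  refine Eq.trans ?_ (this.trans ?_)
  · refine integral_congr_ae (.of_forall fun ω => ?_)
    simp [Set.indicator_apply]
  · refine integral_congr_ae (.of_forall fun ω => ?_)
    simp only [Set.indicator_apply, Set.mem_ofPred_eq]
    split_ifs with hω
    · rw [hω]
    · simp

/-- A random variable has conditional expectation `f(W)` given `W` as soon as it has the same
integrals as `f(W)` against all functions of `W`. -/
theorem condExp_sigmaAlg_W (h : IsParityModel P J K L) {X : Ω → ℝ} (hX : Integrable X P)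
    (f : ℤ → ℝ) (hf : ∀ g : ℤ → ℝ, ∫ ω, g (W J ω) * X ω ∂P = ∫ ω, g (W J ω) * f (W J ω) ∂P) :
    P[X | sigmaAlg (W J)] =ᵐ[P] fun ω => f (W J ω) := by
  have hle : sigmaAlg (W J) ≤ (inferInstance : MeasurableSpace Ω) := (measurable_W h).comap_le
  refine (ae_eq_condExp_of_forall_setIntegral_eq hle hX
    (fun s _ _ => (integrable_comp_W h f).integrableOn) ?_ ?_).symm
  · rintro s ⟨T, hT, rfl⟩ -
    have hs := measurable_W h hT
    rw [← integral_indicator hs, ← integral_indicator hs]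
    have := hf (T.indicator 1)
    refine Eq.trans ?_ (this.symm.trans ?_) <;>
    · refine integral_congr_ae (.of_forall fun ω => ?_)
      by_cases hω : W J ω ∈ T <;> simp [hω]
  · have hW : Measurable[sigmaAlg (W J)] (W J) := comap_measurable _
    exact (Measurable.of_discrete.comp hW).aestronglyMeasurable

theorem upProb_ae_eq (hn : 1 ≤ n) (h : IsParityModel P J K L) :
    upProb P (W J) (W' J K L) =ᵐ[P] fun ω => upRate n (W J ω) := by
  have hX : ({ω | W' J K L ω = W J ω + 1} : Set Ω).indicator (fun _ => (1 : ℝ)) =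
      fun ω => (1 - (bit J (K ω) ω : ℝ)) * (1 - (bit J (L ω) ω : ℝ)) :=
    funext indicator_up_eq
  rw [upProb, hX]
  exact condExp_sigmaAlg_W h
    (integrable_comp_W_bit h fun _ a b => (1 - (a : ℝ)) * (1 - (b : ℝ))) (upRate n)
    (integral_mul_up hn h)

theorem integral_upRate_eq (hn : 1 ≤ n) (h : IsParityModel P J K L) :
    ∫ ω, upRate n (W J ω) ∂P = ∫ ω, downRate n (W J ω) ∂P := by
  simpa using integral_upRate_mul hn h fun _ => 1

/-- Up and down jumps are equally likely overall, and their conditional difference is affine in W,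
so E W is the root of that affine function. -/
theorem mean_W (hn : 1 ≤ n) (h : IsParityModel P J K L) :
    mean P (W J) = ((n : ℝ) + 1) / 4 := by
  have h1 : ∫ ω, (upRate n (W J ω) - downRate n (W J ω)) ∂P = 0 := by
    rw [integral_sub (integrable_comp_W h _) (integrable_comp_W h _), integral_upRate_eq hn h,
      sub_self]
  have h2 : ∫ ω, (1 - 4 / ((n : ℝ) + 1) * (W J ω : ℝ)) ∂P = 0 := by
    rw [← h1]
    refine integral_congr_ae (.of_forall fun ω => ?_)
    simp only [upRate_sub_downRate hn]
    ring
  rw [integral_sub (integrable_const _) ((integrable_comp_W h fun k => (k : ℝ)).const_mul _),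
    integral_const_mul] at h2
  have h3 : 4 / ((n : ℝ) + 1) * mean P (W J) = 1 := by
    unfold mean
    simp at h2 ⊢
    linarith
  field_simp at h3 ⊢
  linarith

theorem upRate_sub_downRate_eq_mean (hn : 1 ≤ n) (h : IsParityModel P J K L) (k : ℤ) :
    upRate n k - downRate n k = -(4 / ((n : ℝ) + 1)) * ((k : ℝ) - mean P (W J)) := by
  rw [upRate_sub_downRate hn, mean_W hn h]
  field_simp
  ring

theorem linearRegression (hn : 1 ≤ n) (h : IsParityModel P J K L) :
    LinearRegression P (W J) (W' J K L) (4 / ((n : ℝ) + 1)) 0 := by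
  set μ := mean P (W J) with hμ
  -- For bits a and b, 1 - a - b = (1 - a)(1 - b) - a b, the up indicator minus the down indicator.
  have hX : (fun ω => (W' J K L ω : ℝ) - μ) =
      fun ω => ((W J ω : ℝ) - μ) + ((1 - (bit J (K ω) ω : ℝ)) * (1 - (bit J (L ω) ω : ℝ))
        - (bit J (K ω) ω : ℝ) * (bit J (L ω) ω : ℝ)) := by
    funext ω
    rw [W'_eq]
    push_cast
    ring
  have hR : (fun ω => (1 - 4 / ((n : ℝ) + 1)) * ((W J ω : ℝ) - μ) + (0 : Ω → ℝ) ω) =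
      fun ω => ((W J ω : ℝ) - μ) + (upRate n (W J ω) - downRate n (W J ω)) := by
    funext ω
    rw [upRate_sub_downRate_eq_mean hn h, Pi.zero_apply, ← hμ]
    ring
  unfold LinearRegression
  rw [← hμ, hX, hR]
  refine condExp_sigmaAlg_W h
    (integrable_comp_W_bit h fun k a b => ((k : ℝ) - μ) +
      ((1 - (a : ℝ)) * (1 - (b : ℝ)) - (a : ℝ) * (b : ℝ)))
    (fun k => ((k : ℝ) - μ) + (upRate n k - downRate n k)) fun g => ?_
  simp only [mul_add, mul_sub (g _) (_ * _), mul_sub (g _) (upRate _ _)]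
  rw [integral_add (integrable_comp_W h fun k => g k * ((k : ℝ) - μ)), integral_sub,
    integral_mul_up hn h, integral_mul_down hn h,
    integral_add (integrable_comp_W h fun k => g k * ((k : ℝ) - μ)), integral_sub]
  · exact integrable_comp_W h fun k => g k * upRate n k
  · exact integrable_comp_W h fun k => g k * downRate n k
  · exact (integrable_comp_W h fun k => g k * upRate n k).sub
      (integrable_comp_W h fun k => g k * downRate n k)
  · exact integrable_comp_W_bit h fun k a b => g k * ((1 - (a : ℝ)) * (1 - (b : ℝ)))
  · exact integrable_comp_W_bit h fun k a b => g k * ((a : ℝ) * (b : ℝ))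
  · exact integrable_comp_W_bit h fun k a b => g k * ((1 - (a : ℝ)) * (1 - (b : ℝ))) -
      g k * ((a : ℝ) * (b : ℝ))

end Model

/-! ### Finitely supported laws on the integers: variances and modes -/

theorem sum_sum_mul_sub_sq {ι : Type*} (B : Finset ι) (q f : ι → ℝ) (hq1 : ∑ k ∈ B, q k = 1) :
    ∑ k ∈ B, ∑ l ∈ B, q k * q l * (f k - f l) ^ 2 =
      2 * ∑ k ∈ B, q k * (f k - ∑ l ∈ B, q l * f l) ^ 2 := by
  set e := ∑ l ∈ B, q l * f l with he
  have h0 : ∑ k ∈ B, q k * (f k - e) = 0 := by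
    simp only [mul_sub, Finset.sum_sub_distrib, ← Finset.sum_mul, hq1, ← he]
    ring
  have h1 : ∀ k l, q k * q l * (f k - f l) ^ 2 = q k * (f k - e) ^ 2 * q l
      + q k * (q l * (f l - e) ^ 2) - 2 * ((q k * (f k - e)) * (q l * (f l - e))) := by
    intro k l
    ring
  simp only [h1, Finset.sum_sub_distrib, Finset.sum_add_distrib, ← Finset.mul_sum, h0,
    ← Finset.sum_mul, hq1]
  ring

/-- Writing each variance as half the mean square difference of two independent copies removes the
means, so a pointwise comparison of differences on the support suffices. -/
theorem sum_mul_sub_sq_le_of_lipschitz {ι : Type*} (B : Finset ι) (q f g : ι → ℝ)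
    (hq : ∀ k, 0 ≤ q k) (hq1 : ∑ k ∈ B, q k = 1) (c : ℝ)
    (hfg : ∀ k ∈ B, ∀ l ∈ B, q k ≠ 0 → q l ≠ 0 → (f k - f l) ^ 2 ≤ c * (g k - g l) ^ 2) :
    ∑ k ∈ B, q k * (f k - ∑ l ∈ B, q l * f l) ^ 2 ≤
      c * ∑ k ∈ B, q k * (g k - ∑ l ∈ B, q l * g l) ^ 2 := by
  have hf := sum_sum_mul_sub_sq B q f hq1
  have hg := sum_sum_mul_sub_sq B q g hq1
  have h : ∑ k ∈ B, ∑ l ∈ B, q k * q l * (f k - f l) ^ 2 ≤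
      c * ∑ k ∈ B, ∑ l ∈ B, q k * q l * (g k - g l) ^ 2 := by
    rw [Finset.mul_sum]
    refine Finset.sum_le_sum fun k hk => ?_
    rw [Finset.mul_sum]
    refine Finset.sum_le_sum fun l hl => ?_
    by_cases hk0 : q k = 0
    · simp [hk0]
    by_cases hl0 : q l = 0
    · simp [hl0]
    calc q k * q l * (f k - f l) ^ 2 ≤ q k * q l * (c * (g k - g l) ^ 2) :=
          mul_le_mul_of_nonneg_left (hfg k hk l hl hk0 hl0) (mul_nonneg (hq k) (hq l))
      _ = c * (q k * q l * (g k - g l) ^ 2) := by ring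
  rw [hf, hg] at h
  linarith

/-- A mass function that decreases to the right of `μ` is at most `1 / (k - μ)` there. -/
theorem mul_sub_le_one_of_antitone {q : ℤ → ℝ} (hq : ∀ k, 0 ≤ q k)
    (hq1 : ∀ F : Finset ℤ, ∑ k ∈ F, q k ≤ 1) {μ : ℝ}
    (hdec : ∀ k : ℤ, μ ≤ k → q (k + 1) ≤ q k) (k : ℤ) : q k * (k - μ) ≤ 1 := by
  rcases lt_or_ge (k : ℝ) μ with hk | hk
  · have := mul_nonneg (hq k) (sub_nonneg.mpr hk.le)
    linarith
  · have hmono : ∀ j : ℤ, μ ≤ j → ∀ i, j ≤ i → q i ≤ q j := by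
      intro j hj i hi
      induction i, hi using Int.leInduction with
      | base => exact le_rfl
      | succ i hi ih => exact (hdec i (hj.trans (by exact_mod_cast hi))).trans ih
    have h1 : ∑ _j ∈ Finset.Icc ⌈μ⌉ k, q k ≤ ∑ j ∈ Finset.Icc ⌈μ⌉ k, q j :=
      Finset.sum_le_sum fun j hj => by
        rw [Finset.mem_Icc] at hj
        exact hmono j (Int.ceil_le.mp hj.1) k hj.2
    rw [Finset.sum_const, nsmul_eq_mul, Int.card_Icc] at h1
    have hceil : ⌈μ⌉ ≤ k := Int.ceil_le.mpr hk
    have h2 : (((k + 1 - ⌈μ⌉).toNat : ℕ) : ℝ) = (k : ℝ) + 1 - ⌈μ⌉ := by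
      have : (((k + 1 - ⌈μ⌉).toNat : ℕ) : ℤ) = k + 1 - ⌈μ⌉ := Int.toNat_of_nonneg (by omega)
      exact_mod_cast congrArg (Int.cast : ℤ → ℝ) this
    have h3 := Int.ceil_lt_add_one μ
    calc q k * (k - μ) ≤ q k * (k + 1 - ⌈μ⌉) :=
          mul_le_mul_of_nonneg_left (by linarith) (hq k)
      _ = ((k + 1 - ⌈μ⌉).toNat : ℝ) * q k := by rw [h2, mul_comm]
      _ ≤ 1 := h1.trans (hq1 _)

/-- The left side follows from the right one by reflection k ↦ -k. -/
theorem mul_abs_sub_le_one_of_unimodal {q : ℤ → ℝ} (hq : ∀ k, 0 ≤ q k)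
    (hq1 : ∀ F : Finset ℤ, ∑ k ∈ F, q k ≤ 1) {μ : ℝ}
    (hdec : ∀ k : ℤ, μ ≤ k → q (k + 1) ≤ q k)
    (hinc : ∀ k : ℤ, (k : ℝ) + 1 ≤ μ → q k ≤ q (k + 1)) (k : ℤ) : q k * |(k : ℝ) - μ| ≤ 1 := by
  have h1 := mul_sub_le_one_of_antitone hq hq1 hdec k
  have h2 := mul_sub_le_one_of_antitone (q := fun k => q (-k)) (μ := -μ) (fun k => hq _)
    (fun F => by
      have := hq1 (F.map (Equiv.neg ℤ).toEmbedding)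
      rwa [Finset.sum_map] at this)
    (fun k hk => by
      have := hinc (-k - 1) (by push_cast; linarith)
      rw [sub_add_cancel] at this
      rwa [neg_add']) (-k)
  rw [neg_neg] at h2
  push_cast at h2
  rcases abs_cases ((k : ℝ) - μ) with ⟨h, -⟩ | ⟨h, -⟩ <;> rw [h] <;> linarith

/-! ### Moments of the model -/

section Model

variable {Ω : Type*} {n : ℕ} {J : Fin n → Ω → Bool} {K L : Ω → Fin (n + 1)}
  [MeasurableSpace Ω] {P : Measure Ω}

theorem prob_W_eq_zero {k : ℤ} (hk : k < 0 ∨ (n : ℤ) + 1 < 2 * k) :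
    P.real {ω | W J ω = k} = 0 := by
  have : {ω | W J ω = k} = ∅ := by
    ext ω
    have h1 := W_nonneg (J := J) ω
    have h2 := two_mul_W_le (J := J) ω
    simp only [Set.mem_ofPred_eq, Set.mem_empty_iff_false, iff_false]
    omega
  rw [this, measureReal_empty]

variable [IsProbabilityMeasure P]

theorem integral_comp_W (h : IsParityModel P J K L) (g : ℤ → ℝ) :
    ∫ ω, g (W J ω) ∂P =
      ∑ k ∈ Finset.Icc (0 : ℤ) (n + 1), P.real {ω | W J ω = k} * g k := by
  have hpt : ∀ ω, g (W J ω) =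
      ∑ k ∈ Finset.Icc (0 : ℤ) (n + 1), (W J ⁻¹' {k}).indicator (fun _ => g k) ω := by
    intro ω
    rw [Finset.sum_eq_single_of_mem _ (W_mem_Icc (J := J) ω)]
    · simp
    · intro k _ hk
      simp [hk.symm]
  have hmeas : ∀ k, MeasurableSet (W J ⁻¹' {k}) := fun k =>
    measurable_W h (measurableSet_singleton k)
  simp only [hpt]
  rw [integral_finsetSum _ fun k _ => (integrable_const _).indicator (hmeas k)]
  refine Finset.sum_congr rfl fun k _ => ?_
  rw [integral_indicator_const _ (hmeas k), smul_eq_mul]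
  rfl

theorem sum_prob_W (h : IsParityModel P J K L) :
    ∑ k ∈ Finset.Icc (0 : ℤ) (n + 1), P.real {ω | W J ω = k} = 1 := by
  have := integral_comp_W h fun _ => 1
  simpa using this.symm

theorem sum_prob_W_le_one (h : IsParityModel P J K L) (F : Finset ℤ) :
    ∑ k ∈ F, P.real {ω | W J ω = k} ≤ 1 := by
  have := measureReal_biUnion_finset (μ := P) (s := F) (f := fun k => {ω | W J ω = k})
    (fun i _ j _ hij => Set.disjoint_left.mpr fun ω hi hj => hij (hi.symm.trans hj))
    (fun k _ => measurable_W h (measurableSet_singleton k))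
  rw [← this]
  exact measureReal_le_one

theorem law_real (h : IsParityModel P J K L) (A : Set ℤ) :
    (law P (W J)).real A =
      ∑ k ∈ Finset.Icc (0 : ℤ) (n + 1), P.real {ω | W J ω = k} * A.indicator 1 k := by
  rw [← integral_comp_W h, law, map_measureReal_apply (measurable_W h) .of_discrete,
    ← integral_indicator_one (measurable_W h .of_discrete)]
  rfl

theorem var_W_eq_integral (h : IsParityModel P J K L) :
    var P (W J) = ∫ ω, ((W J ω : ℝ) - mean P (W J)) ^ 2 ∂P :=
  variance_eq_integral (integrable_comp_W h fun k => (k : ℝ)).aemeasurable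

theorem var_W_eq_sum (h : IsParityModel P J K L) :
    var P (W J) = ∑ k ∈ Finset.Icc (0 : ℤ) (n + 1),
      P.real {ω | W J ω = k} * ((k : ℝ) - mean P (W J)) ^ 2 :=
  (var_W_eq_integral h).trans (integral_comp_W h fun k => ((k : ℝ) - mean P (W J)) ^ 2)

/-- By the jump balance the right side is the integral of g(W) times down rate minus up rate, which
is the linear drift. -/
theorem stein_identity_W (hn : 1 ≤ n) (h : IsParityModel P J K L) (g : ℤ → ℝ) :
    4 / ((n : ℝ) + 1) * ∫ ω, ((W J ω : ℝ) - mean P (W J)) * g (W J ω) ∂P =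
      ∫ ω, upRate n (W J ω) * (g (W J ω + 1) - g (W J ω)) ∂P := by
  have h1 := integral_upRate_mul hn h g
  have h2 : ∫ ω, upRate n (W J ω) * (g (W J ω + 1) - g (W J ω)) ∂P =
      ∫ ω, g (W J ω + 1) * upRate n (W J ω) ∂P - ∫ ω, g (W J ω) * upRate n (W J ω) ∂P := by
    rw [← integral_sub (integrable_comp_W h fun k => g (k + 1) * upRate n k)
      (integrable_comp_W h fun k => g k * upRate n k)]
    refine integral_congr_ae (.of_forall fun ω => ?_)
    simp only
    ring
  rw [h2, h1, ← integral_sub (integrable_comp_W h fun k => g k * downRate n k)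
      (integrable_comp_W h fun k => g k * upRate n k), ← integral_const_mul]
  refine integral_congr_ae (.of_forall fun ω => ?_)
  have := upRate_sub_downRate_eq_mean hn h (W J ω)
  simp only
  linear_combination g (W J ω) * this

theorem stein_identity_W_sum (hn : 1 ≤ n) (h : IsParityModel P J K L) (g : ℤ → ℝ) :
    4 / ((n : ℝ) + 1) * ∑ k ∈ Finset.Icc (0 : ℤ) (n + 1),
        P.real {ω | W J ω = k} * (((k : ℝ) - mean P (W J)) * g k) =
      ∑ k ∈ Finset.Icc (0 : ℤ) (n + 1),
        P.real {ω | W J ω = k} * (upRate n k * (g (k + 1) - g k)) := by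
  rw [← integral_comp_W h fun k => ((k : ℝ) - mean P (W J)) * g k,
    ← integral_comp_W h fun k => upRate n k * (g (k + 1) - g k)]
  exact stein_identity_W hn h g

theorem integral_upRate_eq_var (hn : 1 ≤ n) (h : IsParityModel P J K L) :
    ∫ ω, upRate n (W J ω) ∂P = 4 / ((n : ℝ) + 1) * var P (W J) := by
  have := stein_identity_W hn h fun k => (k : ℝ) - mean P (W J)
  rw [var_W_eq_integral h]
  simp only [sq]
  rw [this]
  refine integral_congr_ae (.of_forall fun ω => ?_)
  simp only
  push_cast
  ring

theorem upRate_eq_of_mean (hn : 1 ≤ n) (k : ℤ) :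
    upRate n k = (((n : ℝ) ^ 2 - 1) / 4 - 2 * n * ((k : ℝ) - (n + 1) / 4)
      + 4 * ((k : ℝ) - (n + 1) / 4) ^ 2) / (n * (n + 1)) := by
  have : (0 : ℝ) < n := by exact_mod_cast hn
  unfold upRate
  congr 1
  ring

/-- The mean of S is computed twice: from the Stein identity, and by expanding the quadratic
`upRate` about μ. Equating gives (n - 1)(16 σ² - (n + 1)) = 0, which carries no information when n =
1. -/
theorem var_W_of_two_le (hn : 2 ≤ n) (h : IsParityModel P J K L) :
    var P (W J) = ((n : ℝ) + 1) / 16 := by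
  have hn1 : 1 ≤ n := by omega
  have hn' : (2 : ℝ) ≤ n := by exact_mod_cast hn
  have h1 := integral_upRate_eq_var hn1 h
  have hm := mean_W hn1 h
  have hint : Integrable (fun ω => ((W J ω : ℝ) - mean P (W J))) P :=
    integrable_comp_W h fun k => (k : ℝ) - mean P (W J)
  have hint2 : Integrable (fun ω => ((W J ω : ℝ) - mean P (W J)) ^ 2) P :=
    integrable_comp_W h fun k => ((k : ℝ) - mean P (W J)) ^ 2
  have h0 : ∫ ω, ((W J ω : ℝ) - mean P (W J)) ∂P = 0 := by
    rw [integral_sub (integrable_comp_W h fun k => (k : ℝ)) (integrable_const _)]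
    simp [mean]
  have h2 : ∫ ω, upRate n (W J ω) ∂P =
      (((n : ℝ) ^ 2 - 1) / 4 + 4 * var P (W J)) / (n * (n + 1)) := by
    rw [var_W_eq_integral h]
    simp only [upRate_eq_of_mean hn1, ← hm]
    rw [integral_div, integral_add (integrable_comp_W h fun k =>
        ((n : ℝ) ^ 2 - 1) / 4 - 2 * n * ((k : ℝ) - mean P (W J))) (hint2.const_mul _),
      integral_sub (integrable_const _) (hint.const_mul _),
      integral_const_mul, integral_const_mul, h0]
    simp
  rw [h1] at h2
  field_simp at h2
  have h3 : ((n : ℝ) - 1) * (16 * var P (W J) - (n + 1)) = 0 := by linarith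
  rcases mul_eq_zero.mp h3 with h4 | h4 <;> linarith

theorem var_W_pos (hn : 1 ≤ n) (h : IsParityModel P J K L) : 0 < var P (W J) := by
  rcases eq_or_lt_of_le hn with rfl | hn2
  -- For n = 1, W takes only the values 0 and 1, where `upRate` agrees with 1 - W; this gives σ² =
  -- 1/4.
  · have h1 := integral_upRate_eq_var le_rfl h
    have hm := mean_W le_rfl h
    have h2 : ∫ ω, upRate 1 (W J ω) ∂P = ∫ ω, (1 - (W J ω : ℝ)) ∂P := by
      refine integral_congr_ae (.of_forall fun ω => ?_)
      have h3 := W_nonneg (J := J) ω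
      have h4 := two_mul_W_le (J := J) ω
      obtain h5 | h5 : W J ω = 0 ∨ W J ω = 1 := by push_cast at h4; omega
      all_goals
        simp only [h5, upRate]
        norm_num
    rw [integral_sub (integrable_const _) (integrable_comp_W h fun k => (k : ℝ))] at h2
    change _ = _ - mean P (W J) at h2
    rw [h1, hm] at h2
    norm_num at h2
    linarith
  · rw [var_W_of_two_le hn2 h]
    positivity

theorem variance_upProb (hn : 1 ≤ n) (h : IsParityModel P J K L) :
    variance (upProb P (W J) (W' J K L)) P = ∑ k ∈ Finset.Icc (0 : ℤ) (n + 1),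
      P.real {ω | W J ω = k} * (upRate n k -
        ∑ k ∈ Finset.Icc (0 : ℤ) (n + 1), P.real {ω | W J ω = k} * upRate n k) ^ 2 := by
  rw [variance_congr (upProb_ae_eq hn h),
    variance_eq_integral (integrable_comp_W h (upRate n)).aemeasurable, integral_comp_W h,
    integral_comp_W h fun k => (upRate n k - _) ^ 2]

theorem sq_upRate_sub_le (hn : 1 ≤ n) {k l : ℤ} (hk0 : 0 ≤ k) (hl0 : 0 ≤ l)
    (hk : 2 * k ≤ n + 1) (hl : 2 * l ≤ n + 1) :
    (upRate n k - upRate n l) ^ 2 ≤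
      ((4 * (n : ℝ) - 2) / (n * (n + 1))) ^ 2 * ((k : ℝ) - l) ^ 2 := by
  have hn' : (1 : ℝ) ≤ n := by exact_mod_cast hn
  rcases eq_or_ne k l with rfl | hkl
  · simp
  · have h1 : upRate n k - upRate n l =
        (2 * (2 * n + 1 - 2 * k - 2 * l)) / (n * (n + 1)) * (l - k) := by
      unfold upRate
      field_simp
      ring
    -- Distinctness of k and l in [0, (n + 1)/2] forces 1 ≤ k + l ≤ n, so the difference quotient
    -- has absolute value at most (4n - 2)/(n(n + 1)).
    have h2 : (1 : ℝ) ≤ k + l := by exact_mod_cast (by omega : 1 ≤ k + l)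
    have h3 : (k : ℝ) + l ≤ n := by exact_mod_cast (by omega : k + l ≤ n)
    rw [h1, mul_pow, div_pow, div_pow, show ((l : ℝ) - k) ^ 2 = ((k : ℝ) - l) ^ 2 by ring]
    gcongr
    · linarith
    · linarith

theorem variance_upProb_le (hn : 2 ≤ n) (h : IsParityModel P J K L) :
    variance (upProb P (W J) (W' J K L)) P ≤
      (4 * (n : ℝ) - 2) ^ 2 * ((n : ℝ) + 1) / (16 * (n : ℝ) ^ 2 * ((n : ℝ) + 1) ^ 2) := by
  have hn1 : 1 ≤ n := by omega
  have hv := var_W_eq_sum h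
  have hmean : mean P (W J) =
      ∑ k ∈ Finset.Icc (0 : ℤ) (n + 1), P.real {ω | W J ω = k} * (k : ℝ) :=
    integral_comp_W h fun k => (k : ℝ)
  rw [hmean] at hv
  rw [variance_upProb hn1 h]
  refine (sum_mul_sub_sq_le_of_lipschitz _ _ _ (fun k : ℤ => (k : ℝ))
    (fun k => measureReal_nonneg) (sum_prob_W h) (((4 * (n : ℝ) - 2) / (n * (n + 1))) ^ 2)
    fun k _ l _ hk hl => ?_).trans_eq ?_
  · have hsupp : ∀ k : ℤ, P.real {ω | W J ω = k} ≠ 0 → 0 ≤ k ∧ 2 * k ≤ n + 1 := by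
      intro k hk
      by_contra hc
      exact hk (prob_W_eq_zero (by omega))
    exact sq_upRate_sub_le hn1 (hsupp k hk).1 (hsupp l hl).1 (hsupp k hk).2 (hsupp l hl).2
  · rw [← hv, var_W_of_two_le hn h]
    have : (0 : ℝ) < n := by exact_mod_cast (by omega : 0 < n)
    field_simp

theorem prob_W_mul_upRate (hn : 1 ≤ n) (h : IsParityModel P J K L) (k : ℤ) :
    P.real {ω | W J ω = k} * upRate n k =
      P.real {ω | W J ω = k + 1} * downRate n (k + 1) := by
  have h1 := integral_upRate_mul hn h (({k + 1} : Set ℤ).indicator 1)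
  have hmeas : ∀ k, MeasurableSet {ω | W J ω = k} := fun k =>
    measurable_W h (measurableSet_singleton k)
  have h2 : ∀ (f : ℤ → ℝ) (k : ℤ), P.real {ω | W J ω = k} * f k =
      ∫ ω, {ω | W J ω = k}.indicator (fun _ => f k) ω ∂P := by
    intro f k
    rw [integral_indicator_const _ (hmeas k), smul_eq_mul]
  rw [h2, h2]
  refine Eq.trans ?_ (h1.trans ?_) <;>
  · refine integral_congr_ae (.of_forall fun ω => ?_)
    simp only [Set.indicator_apply, Set.mem_ofPred_eq, Set.mem_singleton_iff, add_left_inj]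
    split_ifs with hω
    · simp [hω]
    · simp

/-- By detailed balance, the ratio of consecutive masses is `upRate n k / downRate n (k + 1)`. The
numerators differ by (n + 2)(n - 1 - 4k), so the mass function rises before (n - 1)/4 and falls
after it. -/
theorem prob_W_mul_abs_sub_le (hn : 1 ≤ n) (h : IsParityModel P J K L) (k : ℤ) :
    P.real {ω | W J ω = k} * |(k : ℝ) - mean P (W J)| ≤ 1 := by
  have hn' : (1 : ℝ) ≤ n := by exact_mod_cast hn
  refine mul_abs_sub_le_one_of_unimodal (q := fun k => P.real {ω | W J ω = k})
    (fun _ => measureReal_nonneg) (sum_prob_W_le_one h) (fun k hk => ?_) (fun k hk => ?_) k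
  · rw [mean_W hn h] at hk
    have hd : 0 < downRate n (k + 1) := by
      unfold downRate
      push_cast
      have : (0 : ℝ) < k := by linarith
      have : (0 : ℝ) < 2 * (k + 1) - 1 := by linarith
      positivity
    have hle : upRate n k ≤ downRate n (k + 1) := by
      unfold upRate downRate
      push_cast
      refine div_le_div_of_nonneg_right ?_ (by positivity)
      nlinarith
    have := prob_W_mul_upRate hn h k
    refine le_of_mul_le_mul_right ?_ hd
    rw [← this]
    exact mul_le_mul_of_nonneg_left hle measureReal_nonneg
  · rw [mean_W hn h] at hk
    rcases lt_or_ge k 0 with hk0 | hk0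
    · simp only [prob_W_eq_zero (P := P) (J := J) (Or.inl hk0)]
      exact measureReal_nonneg
    have hk0' : (0 : ℝ) ≤ k := by exact_mod_cast hk0
    have hu : 0 < upRate n k := by
      unfold upRate
      have : (0 : ℝ) < n + 1 - 2 * k := by linarith
      have : (0 : ℝ) < n - 2 * k := by linarith
      positivity
    have hle : downRate n (k + 1) ≤ upRate n k := by
      unfold upRate downRate
      push_cast
      refine div_le_div_of_nonneg_right ?_ (by positivity)
      nlinarith
    have := prob_W_mul_upRate hn h k
    refine le_of_mul_le_mul_right ?_ hu
    rw [this]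
    exact mul_le_mul_of_nonneg_left hle measureReal_nonneg

end Model

/-! ### The distance bounds -/

theorem abs_sum_mul_mul_le {ι : Type*} (B : Finset ι) (q u d : ι → ℝ) (hq : ∀ k, 0 ≤ q k)
    {b c : ℝ} (hb : 0 ≤ b) (hd : ∑ k ∈ B, q k * d k ^ 2 ≤ c * b ^ 2) :
    |∑ k ∈ B, q k * (u k * d k)| ≤ b * √(c * ∑ k ∈ B, q k * u k ^ 2) := by
  have h1 := Finset.sum_mul_sq_le_sq_mul_sq B (fun k => √(q k) * u k) (fun k => √(q k) * d k)
  have h2 : ∀ k, √(q k) * u k * (√(q k) * d k) = q k * (u k * d k) := fun k => by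
    linear_combination (u k * d k) * Real.mul_self_sqrt (hq k)
  have h3 : ∀ (v : ι → ℝ) k, (√(q k) * v k) ^ 2 = q k * v k ^ 2 := fun v k => by
    rw [mul_pow, Real.sq_sqrt (hq k)]
  simp only [h2, h3] at h1
  have h4 : 0 ≤ ∑ k ∈ B, q k * u k ^ 2 :=
    Finset.sum_nonneg fun k _ => mul_nonneg (hq k) (sq_nonneg _)
  have h5 : (∑ k ∈ B, q k * (u k * d k)) ^ 2 ≤ b ^ 2 * (c * ∑ k ∈ B, q k * u k ^ 2) := by
    nlinarith
  refine (Real.abs_le_sqrt h5).trans_eq ?_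
  rw [Real.sqrt_mul (sq_nonneg b), Real.sqrt_sq hb]

section Model

variable {Ω : Type*} {n : ℕ} {J : Fin n → Ω → Bool} {K L : Ω → Fin (n + 1)}
  [MeasurableSpace Ω] {P : Measure Ω}

theorem qMax_nonneg : 0 ≤ qMax P (W J) := Real.iSup_nonneg fun _ => measureReal_nonneg

variable [IsProbabilityMeasure P]

theorem exists_steinIncrement_W (hn : 1 ≤ n) (h : IsParityModel P J K L) (A : Set ℤ) :
    ∃ d : ℤ → ℝ, (∀ k, |d k| ≤ 1 / var P (W J)) ∧
      (A.Subsingleton → ∀ F : Finset ℤ, ∑ k ∈ F, |d k| ≤ 2 / var P (W J)) ∧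
      |(law P (W J)).real A - (translatedPoisson (mean P (W J)) (var P (W J))).real A| ≤
        |∑ k ∈ Finset.Icc (0 : ℤ) (n + 1), P.real {ω | W J ω = k} *
          ((upRate n k - ∑ k ∈ Finset.Icc (0 : ℤ) (n + 1),
            P.real {ω | W J ω = k} * upRate n k) * d k)| / (4 / ((n : ℝ) + 1))
          + 2 / var P (W J) := by
  rw [law_real h]
  exact exists_steinIncrement _ _ (upRate n) (fun k => measureReal_nonneg) (sum_prob_W h)
    (var_W_eq_sum h).symm (var_W_pos hn h) (by positivity) (stein_identity_W_sum hn h) A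

theorem prob_W_le_qMax (k : ℤ) : P.real {ω | W J ω = k} ≤ qMax P (W J) :=
  le_ciSup (f := fun k : ℤ => P.real {ω | W J ω = k})
    ⟨1, by rintro _ ⟨k, rfl⟩; exact measureReal_le_one⟩ k

theorem dTV_W_le (hn : 1 ≤ n) (h : IsParityModel P J K L) :
    dTV (law P (W J)) (translatedPoisson (mean P (W J)) (var P (W J))) ≤
      √(variance (upProb P (W J) (W' J K L)) P) / (4 / ((n : ℝ) + 1) * var P (W J))
        + 2 / var P (W J) := by
  have hv := var_W_pos hn h
  refine Real.iSup_le (fun A => ?_) (by positivity)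
  obtain ⟨d, hd, -, hA⟩ := exists_steinIncrement_W hn h A
  refine hA.trans (add_le_add_left ?_ _)
  have hsum : ∑ k ∈ Finset.Icc (0 : ℤ) (n + 1), P.real {ω | W J ω = k} * d k ^ 2 ≤
      1 * (1 / var P (W J)) ^ 2 := by
    refine le_of_le_of_eq ?_ (congrArg (· * (1 / var P (W J)) ^ 2) (sum_prob_W h))
    simp only [Finset.sum_mul]
    refine Finset.sum_le_sum fun k _ => mul_le_mul_of_nonneg_left ?_ measureReal_nonneg
    rw [← sq_abs]
    exact pow_le_pow_left₀ (abs_nonneg _) (hd k) 2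
  have := abs_sum_mul_mul_le _ _ (fun k => upRate n k - ∑ k ∈ Finset.Icc (0 : ℤ) (n + 1),
    P.real {ω | W J ω = k} * upRate n k) d (fun k => measureReal_nonneg) (by positivity) hsum
  rw [one_mul, ← variance_upProb hn h] at this
  calc _ ≤ 1 / var P (W J) * √(variance (upProb P (W J) (W' J K L)) P) / (4 / ((n : ℝ) + 1)) :=
        div_le_div_of_nonneg_right this (by positivity)
    _ = _ := by field_simp

theorem dLoc_W_le (hn : 1 ≤ n) (h : IsParityModel P J K L) :
    dLoc (law P (W J)) (translatedPoisson (mean P (W J)) (var P (W J))) ≤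
      2 * √(qMax P (W J) * variance (upProb P (W J) (W' J K L)) P)
        / (4 / ((n : ℝ) + 1) * var P (W J)) + 2 / var P (W J) := by
  have hv := var_W_pos hn h
  refine Real.iSup_le (fun j => ?_) (by positivity)
  obtain ⟨d, hd, hd', hA⟩ := exists_steinIncrement_W hn h {j}
  refine hA.trans (add_le_add_left ?_ _)
  -- One factor of |d| is bounded uniformly by 1/σ², and the other is summed to at most 2/σ².
  have hsum : ∑ k ∈ Finset.Icc (0 : ℤ) (n + 1), P.real {ω | W J ω = k} * d k ^ 2 ≤
      qMax P (W J) * (2 / var P (W J)) ^ 2 := by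
    calc ∑ k ∈ Finset.Icc (0 : ℤ) (n + 1), P.real {ω | W J ω = k} * d k ^ 2
        ≤ ∑ k ∈ Finset.Icc (0 : ℤ) (n + 1), qMax P (W J) * (1 / var P (W J)) * |d k| := by
          refine Finset.sum_le_sum fun k _ => ?_
          rw [mul_assoc, ← sq_abs, sq]
          exact mul_le_mul (prob_W_le_qMax k)
            (mul_le_mul_of_nonneg_right (hd k) (abs_nonneg _)) (by positivity) qMax_nonneg
      _ ≤ qMax P (W J) * (1 / var P (W J)) * (2 / var P (W J)) := by
          rw [← Finset.mul_sum]
          exact mul_le_mul_of_nonneg_left (hd' Set.subsingleton_singleton _)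
            (mul_nonneg qMax_nonneg (by positivity))
      _ ≤ qMax P (W J) * (2 / var P (W J)) ^ 2 := by
          rw [mul_assoc, sq]
          refine mul_le_mul_of_nonneg_left ?_ qMax_nonneg
          gcongr
          norm_num
  have := abs_sum_mul_mul_le _ _ (fun k => upRate n k - ∑ k ∈ Finset.Icc (0 : ℤ) (n + 1),
    P.real {ω | W J ω = k} * upRate n k) d (fun k => measureReal_nonneg) (by positivity) hsum
  rw [← variance_upProb hn h] at this
  calc _ ≤ 2 / var P (W J) * √(qMax P (W J) * variance (upProb P (W J) (W' J K L)) P)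
        / (4 / ((n : ℝ) + 1)) := div_le_div_of_nonneg_right this (by positivity)
    _ = _ := by field_simp

theorem tvBound_of_le (hn : 1 ≤ n) (h : IsParityModel P J K L) {lam : ℝ} (hlam : 0 < lam)
    (hle : lam ≤ 4 / ((n : ℝ) + 1)) : TVBound P (W J) (W' J K L) lam 0 := by
  have hv := var_W_pos hn h
  unfold TVBound
  rw [variance_zero, Real.sqrt_zero, mul_zero, zero_div, add_zero]
  refine (dTV_W_le hn h).trans ?_
  gcongr

theorem locBound_of_le (hn : 1 ≤ n) (h : IsParityModel P J K L) {lam : ℝ} (hlam : 0 < lam)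
    (hle : lam ≤ 4 / ((n : ℝ) + 1)) : LocBound P (W J) (W' J K L) lam 0 := by
  have hv := var_W_pos hn h
  unfold LocBound
  rw [variance_zero, Real.sqrt_zero, mul_zero, zero_div, zero_div, add_zero, add_zero]
  refine (dLoc_W_le hn h).trans ?_
  gcongr

/-! ### The rates -/

theorem abs_law_sub_translatedPoisson_le_one (hn : 1 ≤ n) (h : IsParityModel P J K L)
    (A : Set ℤ) :
    |(law P (W J)).real A - (translatedPoisson (mean P (W J)) (var P (W J))).real A| ≤ 1 := by
  have hv := var_W_pos hn h
  have hr := add_pos_of_pos_of_nonneg hv (Int.fract_nonneg (mean P (W J) - var P (W J)))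
  have : IsProbabilityMeasure (law P (W J)) :=
    Measure.isProbabilityMeasure_map (measurable_W h).aemeasurable
  rw [translatedPoisson_real hv]
  have h1 := poissonMass_nonneg hr
    {i : ℕ | (i : ℤ) + ⌊mean P (W J) - var P (W J)⌋ ∈ A}
  have h2 := poissonMass_le_one hr
    {i : ℕ | (i : ℤ) + ⌊mean P (W J) - var P (W J)⌋ ∈ A}
  have h3 : 0 ≤ (law P (W J)).real A := measureReal_nonneg
  have h4 : (law P (W J)).real A ≤ 1 := measureReal_le_one
  rw [abs_le]
  constructor <;> linarith

theorem dTV_W_le_rpow (hn : 2 ≤ n) (h : IsParityModel P J K L) :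
    dTV (law P (W J)) (translatedPoisson (mean P (W J)) (var P (W J))) ≤
      60 * (n : ℝ) ^ (-(1 / 2) : ℝ) := by
  have hn' : (2 : ℝ) ≤ n := by exact_mod_cast hn
  have hn0 : (0 : ℝ) < n := by linarith
  have h1 := dTV_W_le (by omega) h
  rw [var_W_of_two_le hn h] at h1 ⊢
  have h2 : variance (upProb P (W J) (W' J K L)) P ≤ 1 / n := by
    refine (variance_upProb_le hn h).trans ?_
    rw [div_le_div_iff₀ (by positivity) hn0]
    have : (4 * (n : ℝ) - 2) ^ 2 ≤ 16 * (n : ℝ) ^ 2 := by nlinarith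
    have h3 : (4 * (n : ℝ) - 2) ^ 2 * (((n : ℝ) + 1) * n) ≤
        16 * (n : ℝ) ^ 2 * (((n : ℝ) + 1) * ((n : ℝ) + 1)) := by
      gcongr
      linarith
    nlinarith
  have h3 : √(1 / (n : ℝ)) = (n : ℝ) ^ (-(1 / 2) : ℝ) := by
    rw [Real.rpow_neg hn0.le, ← Real.sqrt_eq_rpow, Real.sqrt_div zero_le_one, Real.sqrt_one,
      one_div]
  have h4 : 1 / (n : ℝ) ≤ √(1 / (n : ℝ)) := by
    refine Real.le_sqrt_of_sq_le ?_
    rw [one_div, inv_pow]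
    refine inv_anti₀ hn0 ?_
    nlinarith
  have h5 := Real.sqrt_le_sqrt h2
  rw [← h3]
  refine h1.trans ?_
  have h6 : 4 / ((n : ℝ) + 1) * (((n : ℝ) + 1) / 16) = 1 / 4 := by field_simp; norm_num
  have h7 : 2 / (((n : ℝ) + 1) / 16) ≤ 32 * (1 / n) := by
    rw [div_div_eq_mul_div, mul_one_div]
    gcongr <;> linarith
  rw [h6]
  linarith [Real.sqrt_nonneg (1 / (n : ℝ))]

/-- Here 1/4 is the mean of S. About μ the deviation of S is a constant of order 1/n plus x = k - μ
times a factor of order 1/n. Unimodality absorbs |x| into the point mass. -/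
theorem prob_W_mul_abs_upRate_sub_le (hn : 2 ≤ n) (h : IsParityModel P J K L) (k : ℤ) :
    P.real {ω | W J ω = k} * |upRate n k - 1 / 4| ≤ 13 / (4 * n) := by
  have hn1 : 1 ≤ n := by omega
  have hn' : (2 : ℝ) ≤ n := by exact_mod_cast hn
  by_cases hk : k < 0 ∨ (n : ℤ) + 1 < 2 * k
  · rw [prob_W_eq_zero hk, zero_mul]
    positivity
  · have hk0 : (0 : ℝ) ≤ k := by exact_mod_cast (by omega : 0 ≤ k)
    have hk1 : 2 * (k : ℝ) ≤ n + 1 := by exact_mod_cast (by omega : 2 * k ≤ n + 1)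
    have hq0 : 0 ≤ P.real {ω | W J ω = k} := measureReal_nonneg
    have hq1 : P.real {ω | W J ω = k} ≤ 1 := measureReal_le_one
    have hmul := prob_W_mul_abs_sub_le hn1 h k
    rw [mean_W hn1 h] at hmul
    set x : ℝ := (k : ℝ) - (n + 1) / 4 with hx
    have hxb : |x| ≤ ((n : ℝ) + 1) / 4 := by
      rw [abs_le]
      constructor <;> linarith
    have h1 : upRate n k - 1 / 4 = (-(((n : ℝ) + 1) / 4) + x * (4 * x - 2 * n)) / (n * (n + 1)) := by
      rw [upRate_eq_of_mean hn1, ← hx]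
      field_simp
      ring
    have h2 : |4 * x - 2 * n| ≤ 3 * ((n : ℝ) + 1) := by
      rw [abs_le] at hxb ⊢
      constructor <;> linarith [hxb.1, hxb.2]
    have h3 : |-(((n : ℝ) + 1) / 4) + x * (4 * x - 2 * n)| ≤
        ((n : ℝ) + 1) / 4 + |x| * (3 * ((n : ℝ) + 1)) := by
      refine (abs_add_le _ _).trans ?_
      rw [abs_neg, abs_of_nonneg (by positivity : (0 : ℝ) ≤ ((n : ℝ) + 1) / 4), abs_mul]
      gcongr
    rw [h1, abs_div, abs_of_pos (by positivity : (0 : ℝ) < n * (n + 1)), ← mul_div_assoc]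
    calc _ ≤ (13 / 4 * ((n : ℝ) + 1)) / (n * (n + 1)) := by
          refine div_le_div_of_nonneg_right ?_ (by positivity)
          calc _ ≤ P.real {ω | W J ω = k} * (((n : ℝ) + 1) / 4 + |x| * (3 * ((n : ℝ) + 1))) :=
                mul_le_mul_of_nonneg_left h3 hq0
            _ = P.real {ω | W J ω = k} * (((n : ℝ) + 1) / 4)
                + P.real {ω | W J ω = k} * |x| * (3 * ((n : ℝ) + 1)) := by ring
            _ ≤ 1 * (((n : ℝ) + 1) / 4) + 1 * (3 * ((n : ℝ) + 1)) := by gcongr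
            _ = 13 / 4 * ((n : ℝ) + 1) := by ring
      _ = 13 / (4 * n) := by field_simp

/-- The pointwise bound replaces Cauchy–Schwarz, which would give only order n^(-3/4) even with
q_max of order n^(-1/2). -/
theorem dLoc_W_le_inv (hn : 2 ≤ n) (h : IsParityModel P J K L) :
    dLoc (law P (W J)) (translatedPoisson (mean P (W J)) (var P (W J))) ≤ 60 / n := by
  have hn1 : 1 ≤ n := by omega
  have hn0 : (0 : ℝ) < n := by exact_mod_cast (by omega : 0 < n)
  refine Real.iSup_le (fun j => ?_) (by positivity)
  obtain ⟨d, -, hd, hA⟩ := exists_steinIncrement_W hn1 h {j}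
  refine hA.trans ?_
  have hmean : ∑ k ∈ Finset.Icc (0 : ℤ) (n + 1), P.real {ω | W J ω = k} * upRate n k = 1 / 4 := by
    rw [← integral_comp_W h, integral_upRate_eq_var hn1 h, var_W_of_two_le hn h]
    field_simp
    norm_num
  rw [hmean]
  have h1 : |∑ k ∈ Finset.Icc (0 : ℤ) (n + 1), P.real {ω | W J ω = k} *
      ((upRate n k - 1 / 4) * d k)| ≤ 13 / (4 * n) * (2 / var P (W J)) := by
    calc _ ≤ ∑ k ∈ Finset.Icc (0 : ℤ) (n + 1), 13 / (4 * (n : ℝ)) * |d k| := by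
          refine (Finset.abs_sum_le_sum_abs _ _).trans (Finset.sum_le_sum fun k _ => ?_)
          rw [← mul_assoc, abs_mul, abs_mul, abs_of_nonneg measureReal_nonneg]
          exact mul_le_mul_of_nonneg_right (prob_W_mul_abs_upRate_sub_le hn h k) (abs_nonneg _)
      _ ≤ 13 / (4 * n) * (2 / var P (W J)) := by
          rw [← Finset.mul_sum]
          exact mul_le_mul_of_nonneg_left (hd Set.subsingleton_singleton _) (by positivity)
  rw [var_W_of_two_le hn h] at h1 ⊢
  calc _ ≤ 13 / (4 * (n : ℝ)) * (2 / (((n : ℝ) + 1) / 16)) / (4 / ((n : ℝ) + 1))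
        + 2 / (((n : ℝ) + 1) / 16) := by gcongr
    _ = 26 / n + 32 / (n + 1) := by field_simp; ring
    _ ≤ 26 / n + 32 / n := by gcongr; linarith
    _ ≤ 60 / n := by rw [← add_div]; gcongr; norm_num

end Model

theorem theorem4p4 :
    (∀ (n : ℕ), 1 ≤ n → ∀ (Ω : Type*) [MeasurableSpace Ω] (P : Measure Ω) [IsProbabilityMeasure P]
      (J : Fin n → Ω → Bool) (K L : Ω → Fin (n + 1)), IsParityModel P J K L →
        -- `(W, W')` is an exchangeable pair with steps in `{-1, 0, 1}` and linear drift, `R = 0`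
        IsExchangeablePair P (W J) (W' J K L) ∧
        (∀ ω, W' J K L ω - W J ω ∈ ({-1, 0, 1} : Set ℤ)) ∧
        LinearRegression P (W J) (W' J K L) (4 / ((n : ℝ) + 1)) 0 ∧
        -- the two distance bounds with `R = 0` and `λ = 2 / (n + 1)`
        TVBound P (W J) (W' J K L) (2 / ((n : ℝ) + 1)) 0 ∧
        LocBound P (W J) (W' J K L) (2 / ((n : ℝ) + 1)) 0 ∧
        -- the same bounds with the (sharper) regression constant `λ = 4 / (n + 1)`
        TVBound P (W J) (W' J K L) (4 / ((n : ℝ) + 1)) 0 ∧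
        LocBound P (W J) (W' J K L) (4 / ((n : ℝ) + 1)) 0 ∧
        -- the variances
        (2 ≤ n →
          var P (W J) = ((n : ℝ) + 1) / 16 ∧
          variance (upProb P (W J) (W' J K L)) P ≤
            (4 * (n : ℝ) - 2) ^ 2 * ((n : ℝ) + 1) / (16 * (n : ℝ) ^ 2 * ((n : ℝ) + 1) ^ 2))) ∧
    -- the rates, with an absolute constant
    (∃ C : ℝ, ∀ (n : ℕ), 1 ≤ n → ∀ (Ω : Type*) [MeasurableSpace Ω] (P : Measure Ω)
      [IsProbabilityMeasure P] (J : Fin n → Ω → Bool) (K L : Ω → Fin (n + 1)),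
      IsParityModel P J K L →
        dTV (law P (W J)) (translatedPoisson (mean P (W J)) (var P (W J)))
          ≤ C * (n : ℝ) ^ (-(1 / 2) : ℝ) ∧
        dLoc (law P (W J)) (translatedPoisson (mean P (W J)) (var P (W J)))
          ≤ C * (n : ℝ) ^ (-1 : ℝ)) := by
  refine ⟨fun n hn Ω _ P _ J K L h => ?_, 60, fun n hn Ω _ P _ J K L h => ?_⟩
  · have hlam : 2 / ((n : ℝ) + 1) ≤ 4 / ((n : ℝ) + 1) := by
      gcongr
      norm_num
    exact ⟨isExchangeablePair h, W'_sub_W_mem, linearRegression hn h,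
      tvBound_of_le hn h (by positivity) hlam, locBound_of_le hn h (by positivity) hlam,
      tvBound_of_le hn h (by positivity) le_rfl, locBound_of_le hn h (by positivity) le_rfl,
      fun hn2 => ⟨var_W_of_two_le hn2 h, variance_upProb_le hn2 h⟩⟩
  -- The variance formula is unavailable for n = 1, where the trivial bound 1 on both distances is
  -- enough.
  · rcases eq_or_lt_of_le hn with rfl | hn2
    · constructor
      · refine Real.iSup_le (fun A => ?_) (by norm_num)
        refine (abs_law_sub_translatedPoisson_le_one hn h A).trans ?_
        norm_num
      · refine Real.iSup_le (fun k => ?_) (by norm_num)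
        refine (abs_law_sub_translatedPoisson_le_one hn h {k}).trans ?_
        norm_num
    · refine ⟨dTV_W_le_rpow hn2 h, (dLoc_W_le_inv hn2 h).trans_eq ?_⟩
      rw [Real.rpow_neg_one, div_eq_mul_inv]
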